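/- Let $0<q<1$ with $q^{1/2}>0$. For $a\in\mathbb{C}$ and a base $b\in\{q,q^2\}$ put $(a;b)_r=\prod_{i=0}^{r-1}(1-ab^i)$ for $r\in\mathbb{Z}_{\ge 0}\cup\{\infty\}$, put $(a_1,\ldots,a_m;b)_\infty=\prod_{k=1}^m(a_k;b)_\infty$, and let $${}_8W_7(\alpha_0;\alpha_1,\ldots,\alpha_5;b,u)=\sum_{r=0}^\infty\frac{1-\alpha_0b^{2r}}{1-\alpha_0}\,u^r\prod_{j=0}^5\frac{(\alpha_j;b)_r}{(b\alpha_0/\alpha_j;b)_r}$$ be the very-well-poised ${}_8\phi_7$ series. Let $x,z,\alpha,\beta$ be nonzero complex numbers with $|q^{1/2}x|<1$ and $\left|\frac{q\alpha x}{\beta}\right|<1$. Assume that no denominator in the formula below vanishes, that is, $$q\beta xz,\ -\frac{qxz}{\beta},\ \frac{q^{3/2}xz}{\alpha},\ -q^{1/2}\alpha xz,\ qz^2,\ -q^{1/2}xz^2,\ \frac{q^2\beta xz^2}{\alpha}\ \notin\ \{q^{-n}:n\in\mathbb{Z}_{\ge0}\},$$ $$-\frac{q^2xz^2}{\alpha\beta},\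 -q\alpha\beta xz^2,\ q^2z^4,\ -\frac{q\beta xz^4}{\alpha}\ \notin\ \{q^{-2n}:n\in\mathbb{Z}_{\ge0}\}.$$ Then the two ${}_8W_7$ series below converge absolutely and $$\frac{\bigl(q\beta xz,-\frac{qxz}{\beta},\frac{q^{3/2}xz}{\alpha},-q^{1/2}\alpha xz;q\bigr)_\infty}{\bigl(q^{1/2}x,-q^{3/2}xz^2,\frac{q^2\beta xz^2}{\alpha};q\bigr)_\infty}\;{}_8W_7\left(-q^{1/2}xz^2;\frac{qz}{\alpha},-\frac{q^{1/2}z}{\beta},-\alpha z,q^{1/2}\beta z,-q^{1/2}x;q,-q^{1/2}x\right)$$ $$=\frac{\bigl(-\frac{q^2xz^2}{\alpha\beta},-q\alpha\beta xz^2,-\frac{q\alpha x}{\beta};q^2\bigr)_\infty}{\bigl(-\frac{q^3\beta xz^4}{\alpha};q^2\bigr)_\infty}\;{}_8W_7\left(-\frac{q\beta xz^4}{\alpha};\frac{q^2z^2}{\alpha^2},-qz^2,-z^2,q\beta^2z^2,-\frac{q\beta x}{\alpha};q^2,-\frac{q\alpha x}{\beta}\right).$$ -/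

import Mathlib

open Finset

/-- The finite `q`-shifted factorial `(a; q)_r = ∏_{i < r} (1 - a q^i)`. -/
noncomputable def qPoch (a q : ℂ) (r : ℕ) : ℂ := ∏ i ∈ range r, (1 - a * q ^ i)

/-- The infinite `q`-shifted factorial `(a; q)_∞ = ∏_{i ≥ 0} (1 - a q^i)`, for `‖q‖ < 1`. -/
noncomputable def qPochInf (a q : ℂ) : ℂ := ∏' i : ℕ, (1 - a * q ^ i)

/-- The product `(a₁, …, a_m; q)_∞ = (a₁; q)_∞ ⋯ (a_m; q)_∞`. -/
noncomputable def qPochInfs (l : List ℂ) (q : ℂ) : ℂ := (l.map fun a => qPochInf a q).prod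

/-- For `‖q‖ < 1` the infinite product defining `(a; q)_∞` converges. -/
theorem multipliable_qPochInf (a q : ℂ) (hq : ‖q‖ < 1) :
    Multipliable fun i : ℕ => (1 - a * q ^ i) := by
  have h : Summable fun i : ℕ => ‖-(a * q ^ i)‖ := by
    simp only [norm_neg, norm_mul, norm_pow]
    exact (summable_geometric_of_lt_one (norm_nonneg q) hq).mul_left ‖a‖
  simpa [sub_eq_add_neg] using multipliable_one_add_of_summable h

/-- The `r`-th term of the very-well-poised series
`₈W₇(α₀; α₁, α₂, α₃, α₄, α₅; q, z)`, with `α = (α₀, …, α₅)`. -/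
noncomputable def W87Term (α : Fin 6 → ℂ) (q z : ℂ) (r : ℕ) : ℂ :=
  (1 - α 0 * q ^ (2 * r)) / (1 - α 0) * z ^ r *
    ∏ j : Fin 6, qPoch (α j) q r / qPoch (q * α 0 / α j) q r

/-- The very-well-poised series `₈W₇(α₀; α₁, α₂, α₃, α₄, α₅; q, z)`. -/
noncomputable def W87 (α : Fin 6 → ℂ) (q z : ℂ) : ℂ := ∑' r : ℕ, W87Term α q z r

/-! When `α = z q^{n+1}`, both series terminate: `qz/α = q^{-n}` on the left, and `q²z²/α² =
(q²)^{-n}` on the right. Watson's transformation (`W87_watson`) turns each into a balanced `₄φ₃`, in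
base `q` and in base `q²`. Singh's quadratic transformation (`singh_transformation`) says that these
two sums agree up to finite products, which gives `quadratic_transformation_terminating`.

Watson's formula comes from two applications of Bailey's lemma to the unit Bailey pair. Singh's
comes from a `q`-Pfaff–Saalschütz expansion of one factor, an interchange of sums, and a summation
in base `q²` (`qFall_sum`).

The general case follows by analytic continuation in `α` with `ξ = x/α` held fixed. With `x = αξ`
the powers of the arguments absorb the poles of `(qz/α; q)_r` and `(q²z²/α²; q²)_r` at `α = 0`.
After denominators are cleared, both sides are therefore holomorphic on a disc around `0` that
contains the given `α`. They agree at `z q^{n+1}` for all large `n`; these points accumulate at `0`,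
inside the disc, so the identity theorem applies (`quadratic_transformation`). -/

/-! ### Finite `q`-shifted factorials. -/

theorem qPoch_zero (a q : ℂ) : qPoch a q 0 = 1 := by simp [qPoch]

theorem qPoch_succ (a q : ℂ) (n : ℕ) : qPoch a q (n + 1) = qPoch a q n * (1 - a * q ^ n) := by
  simp [qPoch, prod_range_succ]

theorem qPoch_add (a q : ℂ) (m n : ℕ) :
    qPoch a q (m + n) = qPoch a q m * qPoch (a * q ^ m) q n := by
  simp only [qPoch, prod_range_add]
  congr 1
  refine prod_congr rfl fun i _ => ?_
  rw [pow_add]; ring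

theorem qPoch_succ' (a q : ℂ) (n : ℕ) :
    qPoch a q (n + 1) = (1 - a) * qPoch (a * q) q n := by
  rw [add_comm, qPoch_add]; simp [qPoch]

theorem qPoch_ne_zero {a q : ℂ} (h : ∀ n : ℕ, a * q ^ n ≠ 1) (n : ℕ) : qPoch a q n ≠ 0 :=
  prod_ne_zero_iff.mpr fun i _ => sub_ne_zero.mpr (h i).symm

/-! ### Bailey's lemma and Watson's transformation. -/

/-- The `q`-Pfaff–Saalschütz sum. -/
theorem qPfaffSaalschutz {q : ℂ} (hq : ∀ k, qPoch q q k ≠ 0) (d e s c : ℂ) (hc : c = d * e * s)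
    (N : ℕ) :
    ∑ i ∈ range (N + 1), qPoch d q i * qPoch e q i * qPoch s q (N - i) *
        qPoch (c * q ^ i) q (N - i) * s ^ i / (qPoch q q i * qPoch q q (N - i)) =
      qPoch (d * s) q N * qPoch (e * s) q N / qPoch q q N := by
  induction N with
  | zero => simp [qPoch]
  | succ N ih =>
    have hN : 1 - q * q ^ N ≠ 0 := fun h => hq (N + 1) (by rw [qPoch_succ, h, mul_zero])
    let T : ℕ → ℕ → ℂ := fun N i => qPoch d q i * qPoch e q i * qPoch s q (N - i) *
        qPoch (c * q ^ i) q (N - i) * s ^ i / (qPoch q q i * qPoch q q (N - i))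
    -- Telescoping certificate for the first-order recurrence in `N` stated in `step`. The case
    -- split makes `G 0 = 0`, so that no index `k - 1` is ever needed.
    let G : ℕ → ℂ := fun i => Nat.casesOn i 0 fun k =>
      -(q ^ (N - k) * qPoch d q (k + 1) * qPoch e q (k + 1) * qPoch s q (N - k) *
        qPoch (c * q ^ k) q (N - k) * s ^ (k + 1) / (qPoch q q k * qPoch q q (N - k)))
    have G_zero : G 0 = 0 := rfl
    have G_succ : ∀ k, G (k + 1) = -(q ^ (N - k) * qPoch d q (k + 1) * qPoch e q (k + 1) *
        qPoch s q (N - k) * qPoch (c * q ^ k) q (N - k) * s ^ (k + 1) /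
          (qPoch q q k * qPoch q q (N - k))) := fun _ => rfl
    clear_value G
    have step : ∀ i ∈ range (N + 1), (1 - q * q ^ N) * T (N + 1) i =
        (1 - d * s * q ^ N) * (1 - e * s * q ^ N) * T N i + (G (i + 1) - G i) := by
      intro i hi
      obtain ⟨m, rfl⟩ := Nat.exists_eq_add_of_le (Nat.lt_succ_iff.mp (mem_range.mp hi))
      have h1 := hq m
      have h2 : 1 - q * q ^ m ≠ 0 := fun h => hq (m + 1) (by rw [qPoch_succ, h, mul_zero])
      cases i with
      | zero =>
        rw [G_zero, G_succ]
        simp only [T, Nat.sub_zero, zero_add, qPoch_succ, qPoch_zero, pow_zero, mul_one, one_mul,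
          hc]
        field_simp
        ring
      | succ k =>
        have h3 := hq k
        have h4 : 1 - q * q ^ k ≠ 0 := fun h => hq (k + 1) (by rw [qPoch_succ, h, mul_zero])
        have e1 : k + 1 + m + 1 - (k + 1) = m + 1 := by omega
        have e2 : k + 1 + m - (k + 1) = m := by omega
        have e3 : k + 1 + m - k = m + 1 := by omega
        have e4 : qPoch (c * q ^ k) q (m + 1) = (1 - c * q ^ k) * qPoch (c * q ^ (k + 1)) q m := by
          rw [qPoch_succ', pow_succ, mul_assoc]
        rw [G_succ, G_succ]
        simp only [T, e1, e2, e3, e4, qPoch_succ]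
        subst hc
        field_simp
        ring
    -- The top index has no counterpart in the sum for `N`, where `N - i` would be truncated; its
    -- term cancels the boundary value of `G`.
    have last : (1 - q * q ^ N) * T (N + 1) (N + 1) = -G (N + 1) := by
      have := hq N
      rw [G_succ]
      simp only [T, Nat.sub_self, qPoch_zero, qPoch_succ, pow_zero]
      field_simp
    have key : (1 - q * q ^ N) * ∑ i ∈ range (N + 1 + 1), T (N + 1) i =
        (1 - d * s * q ^ N) * (1 - e * s * q ^ N) * ∑ i ∈ range (N + 1), T N i := by
      rw [sum_range_succ, mul_add, last, mul_sum, sum_congr rfl step, sum_add_distrib,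
        sum_range_sub, ← mul_sum]
      simp [G_zero]
    have h5 := hq N
    refine mul_left_cancel₀ hN (key.trans ?_)
    rw [show ∑ i ∈ range (N + 1), T N i = _ from ih]
    simp only [qPoch_succ]
    generalize 1 - q * q ^ N = X at *
    field_simp

/-- The unit Bailey pair. -/
theorem unit_bailey_pair {a q : ℂ} (hq : ∀ k, qPoch q q k ≠ 0) (ha : a ≠ 1)
    (haq : ∀ k, qPoch (a * q) q k ≠ 0) (n : ℕ) :
    ∑ r ∈ range (n + 1), (1 - a * q ^ (2 * r)) / (1 - a) * qPoch a q r / qPoch q q r *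
        (-1) ^ r * q ^ (r.choose 2) / (qPoch q q (n - r) * qPoch (a * q) q (n + r)) =
      if n = 0 then 1 else 0 := by
  have ha' : 1 - a ≠ 0 := sub_ne_zero.mpr ha.symm
  rcases n with _ | n
  · simp [qPoch, ha']
  rw [if_neg (Nat.succ_ne_zero n)]
  have hn : 1 - q * q ^ n ≠ 0 := fun h => hq (n + 1) (by rw [qPoch_succ, h, mul_zero])
  -- The partial sums have a closed product form. It is claimed only up to `n`, since `n - m` is
  -- truncated beyond; the last term, `r = n + 1`, cancels it exactly.
  have partial_sum : ∀ m ≤ n, ∑ r ∈ range (m + 1),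
      (1 - a * q ^ (2 * r)) / (1 - a) * qPoch a q r / qPoch q q r *
        (-1) ^ r * q ^ (r.choose 2) / (qPoch q q (n + 1 - r) * qPoch (a * q) q (n + 1 + r)) =
      (-1) ^ m * q ^ ((m + 1).choose 2) * qPoch (a * q) q m /
        ((1 - q * q ^ n) * qPoch q q m * qPoch q q (n - m) * qPoch (a * q) q (n + 1 + m)) := by
    intro m
    induction m with
    | zero =>
      intro _
      have h1 := hq n
      have h2 := haq (n + 1)
      simp only [zero_add, sum_range_one, mul_zero, pow_zero, mul_one, qPoch_zero, Nat.sub_zero,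
        add_zero, qPoch_succ q q n]
      rw [div_self ha', show Nat.choose 0 2 = 0 from rfl, show Nat.choose 1 2 = 0 from rfl]
      field_simp
    | succ m ih =>
      intro hm
      rw [sum_range_succ, ih (by omega)]
      obtain ⟨l, rfl⟩ := Nat.exists_eq_add_of_le hm
      have h1 := hq m
      have h2 : 1 - q * q ^ m ≠ 0 := fun h => hq (m + 1) (by rw [qPoch_succ, h, mul_zero])
      have h3 := hq l
      have h4 : 1 - q * q ^ l ≠ 0 := fun h => hq (l + 1) (by rw [qPoch_succ, h, mul_zero])
      have h5 := haq (m + 1 + l + 1 + m)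
      have h6 : 1 - a * q * q ^ (m + 1 + l + 1 + m) ≠ 0 :=
        fun h => haq (m + 1 + l + 1 + m + 1) (by rw [qPoch_succ, h, mul_zero])
      have e1 : m + 1 + l + 1 - (m + 1) = l + 1 := by omega
      have e2 : m + 1 + l - m = l + 1 := by omega
      have e3 : m + 1 + l - (m + 1) = l := by omega
      have e4 : (m + 1 + 1).choose 2 = m + 1 + (m + 1).choose 2 := by
        rw [Nat.choose_succ_succ' (m + 1) 1, Nat.choose_one_right]
      rw [e1, e2, e3, e4, ← Nat.add_assoc (m + 1 + l + 1) m 1, qPoch_succ' a, qPoch_succ _ _ m,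
        qPoch_succ _ _ m, qPoch_succ _ _ l, qPoch_succ _ _ (m + 1 + l + 1 + m)]
      generalize qPoch (a * q) q (m + 1 + l + 1 + m) = X at *
      field_simp
      ring
  have h1 := hq n
  have h2 := haq (n + 1 + n)
  have h3 : 1 - a * q * q ^ (n + 1 + n) ≠ 0 :=
    fun h => haq (n + 1 + n + 1) (by rw [qPoch_succ, h, mul_zero])
  have e4 : (n + 1 + 1).choose 2 = n + 1 + (n + 1).choose 2 := by
    rw [Nat.choose_succ_succ' (n + 1) 1, Nat.choose_one_right]
  rw [sum_range_succ, partial_sum n le_rfl, Nat.sub_self, Nat.sub_self,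
    ← Nat.add_assoc (n + 1) n 1, qPoch_succ' a, qPoch_succ _ _ n, qPoch_succ _ _ (n + 1 + n),
    qPoch_zero]
  generalize qPoch (a * q) q (n + 1 + n) = X at *
  field_simp
  ring

/-- Bailey's lemma (finite form). -/
theorem bailey_lemma {a q d e s : ℂ} (hq : ∀ k, qPoch q q k ≠ 0)
    (haq : ∀ k, qPoch (a * q) q k ≠ 0) (hds : ∀ k, qPoch (d * s) q k ≠ 0)
    (hes : ∀ k, qPoch (e * s) q k ≠ 0) (hs : a * q = d * e * s) (A β : ℕ → ℂ)
    (hβ : ∀ j, ∑ r ∈ range (j + 1), A r / (qPoch q q (j - r) * qPoch (a * q) q (j + r)) = β j)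
    (n : ℕ) :
    ∑ r ∈ range (n + 1), qPoch d q r * qPoch e q r * s ^ r / (qPoch (d * s) q r *
        qPoch (e * s) q r) * A r / (qPoch q q (n - r) * qPoch (a * q) q (n + r)) =
      (∑ j ∈ range (n + 1), qPoch d q j * qPoch e q j * qPoch s q (n - j) * s ^ j /
        qPoch q q (n - j) * β j) / (qPoch (d * s) q n * qPoch (e * s) q n) := by
  simp only [← hβ, mul_sum]
  rw [sum_comm' (t' := range (n + 1)) (s' := fun r => Ico r (n + 1))
    (by intro x y; simp only [mem_range, mem_Ico]; omega), sum_div]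
  refine sum_congr rfl fun r hr => ?_
  obtain ⟨N, rfl⟩ := Nat.exists_eq_add_of_le (Nat.lt_succ_iff.mp (mem_range.mp hr))
  rw [sum_Ico_eq_sum_range, show r + N + 1 - r = N + 1 by omega, Nat.add_sub_cancel_left]
  -- After the interchange, the inner sum over `j = r + i` is `q`-Pfaff–Saalschütz with `d` and `e`
  -- shifted by `q^r`; its balancing condition is `a q = d e s` multiplied by `q^{2r}`.
  have hS := qPfaffSaalschutz hq (d * q ^ r) (e * q ^ r) s (a * q * q ^ (2 * r))
    (by rw [hs]; ring) N
  have e0 : qPoch (a * q) q (r + N + r) =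
      qPoch (a * q) q (2 * r) * qPoch (a * q * q ^ (2 * r)) q N := by
    rw [← qPoch_add]; congr 1; omega
  have n0 := haq (r + N + r)
  rw [e0] at n0
  have n1 := left_ne_zero_of_mul n0
  have n2 := right_ne_zero_of_mul n0
  have hsum : ∑ i ∈ range (N + 1), qPoch d q (r + i) * qPoch e q (r + i) *
        qPoch s q (r + N - (r + i)) * s ^ (r + i) / qPoch q q (r + N - (r + i)) *
        (A r / (qPoch q q (r + i - r) * qPoch (a * q) q (r + i + r))) =
      qPoch d q r * qPoch e q r * s ^ r * A r /
        (qPoch (a * q) q (2 * r) * qPoch (a * q * q ^ (2 * r)) q N) *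
      (qPoch (d * q ^ r * s) q N * qPoch (e * q ^ r * s) q N / qPoch q q N) := by
    rw [← hS, mul_sum]
    refine sum_congr rfl fun i hi => ?_
    obtain ⟨m, rfl⟩ := Nat.exists_eq_add_of_le (Nat.lt_succ_iff.mp (mem_range.mp hi))
    have e1 : r + (i + m) - (r + i) = m := by omega
    have e2 : i + m - i = m := by omega
    have e3 : r + i - r = i := by omega
    have e4 : r + i + r = 2 * r + i := by omega
    rw [e1, e2, e3, e4, qPoch_add d, qPoch_add e, qPoch_add (a * q) q (2 * r) i,
      qPoch_add (a * q * q ^ (2 * r)) q i m]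
    have n3 := hq i
    have n4 := hq m
    rw [qPoch_add] at n2
    have n5 := left_ne_zero_of_mul n2
    have n6 := right_ne_zero_of_mul n2
    rw [pow_add]
    generalize qPoch (a * q * q ^ (2 * r) * q ^ i) q m = Y at *
    generalize qPoch (a * q * q ^ (2 * r)) q i = Z at *
    field_simp
  have n7 := hds (r + N)
  have n8 := hes (r + N)
  rw [qPoch_add, show d * s * q ^ r = d * q ^ r * s by ring] at n7
  rw [qPoch_add, show e * s * q ^ r = e * q ^ r * s by ring] at n8
  have n9 := hq N
  rw [hsum, e0, qPoch_add (d * s), qPoch_add (e * s),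
    show d * s * q ^ r = d * q ^ r * s by ring, show e * s * q ^ r = e * q ^ r * s by ring]
  have n10 := left_ne_zero_of_mul n7
  have n11 := right_ne_zero_of_mul n7
  have n12 := left_ne_zero_of_mul n8
  have n13 := right_ne_zero_of_mul n8
  generalize qPoch (a * q * q ^ (2 * r)) q N = Z at *
  generalize qPoch (d * q ^ r * s) q N = X1 at *
  generalize qPoch (e * q ^ r * s) q N = X2 at *
  field_simp

/-- Watson's transformation of a terminating very-well-poised `₈φ₇` series. -/
theorem watson_transformation {a q b c t d e s : ℂ} (hq : ∀ k, qPoch q q k ≠ 0) (ha : a ≠ 1)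
    (haq : ∀ k, qPoch (a * q) q k ≠ 0) (hds : ∀ k, qPoch (d * s) q k ≠ 0)
    (hes : ∀ k, qPoch (e * s) q k ≠ 0) (hs : a * q = d * e * s)
    (hbt : ∀ k, qPoch (b * t) q k ≠ 0) (hct : ∀ k, qPoch (c * t) q k ≠ 0)
    (ht : a * q = b * c * t) (n : ℕ) :
    ∑ r ∈ range (n + 1), qPoch d q r * qPoch e q r * s ^ r / (qPoch (d * s) q r *
        qPoch (e * s) q r) * (qPoch b q r * qPoch c q r * t ^ r / (qPoch (b * t) q r *
        qPoch (c * t) q r) * ((1 - a * q ^ (2 * r)) / (1 - a) * qPoch a q r / qPoch q q r *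
        (-1) ^ r * q ^ (r.choose 2))) / (qPoch q q (n - r) * qPoch (a * q) q (n + r)) =
      (∑ j ∈ range (n + 1), qPoch d q j * qPoch e q j * qPoch s q (n - j) * s ^ j /
        qPoch q q (n - j) * (qPoch t q j / (qPoch q q j * qPoch (b * t) q j *
          qPoch (c * t) q j))) / (qPoch (d * s) q n * qPoch (e * s) q n) := by
  -- Bailey's lemma is applied with `(d, e, s)` to the pair that `(b, c, t)` produces from the unit
  -- pair. For the latter only the summand at index `0` survives.
  refine bailey_lemma hq haq hds hes hs _ _ (fun j => ?_) n
  rw [bailey_lemma hq haq hbt hct ht _ _ (unit_bailey_pair hq ha haq) j, sum_range_succ']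
  have h1 := hq j
  simp [qPoch_zero]
  field_simp

/-! ### Change of base from `q` to `q²` and Singh's transformation. -/

/-- The falling product `∏_{l < k} (1 - q^{M-l})`, which vanishes for `k > M`. -/
noncomputable def qFall (q : ℂ) (M k : ℕ) : ℂ := ∏ l ∈ range k, (1 - q ^ (M - l))

theorem qFall_zero (q : ℂ) (M : ℕ) : qFall q M 0 = 1 := by simp [qFall]

theorem qFall_succ (q : ℂ) (M k : ℕ) :
    qFall q M (k + 1) = qFall q M k * (1 - q ^ (M - k)) := by simp [qFall, prod_range_succ]

theorem qFall_succ_succ (q : ℂ) (M k : ℕ) :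
    qFall q (M + 1) (k + 1) = (1 - q ^ (M + 1)) * qFall q M k := by
  rw [qFall, prod_range_succ', mul_comm]
  simp [qFall]

theorem qFall_add (q : ℂ) (M k l : ℕ) :
    qFall q M (k + l) = qFall q M k * qFall q (M - k) l := by
  simp [qFall, prod_range_add, Nat.sub_sub]

theorem qFall_eq_zero (q : ℂ) {M k : ℕ} (h : M < k) : qFall q M k = 0 :=
  prod_eq_zero (mem_range.mpr h) (by simp)

theorem qFall_mul_qPoch (q : ℂ) (M k : ℕ) :
    qFall q (M + k) k * qPoch q q M = qPoch q q (M + k) := by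
  induction k with
  | zero => simp [qFall]
  | succ k ih => rw [← add_assoc, qFall_succ_succ, qPoch_succ, ← ih]; ring

theorem qPoch_sq_base (q : ℂ) (a : ℂ) (n : ℕ) :
    qPoch (a ^ 2) (q ^ 2) n = qPoch a q n * qPoch (-a) q n := by
  simp only [qPoch, ← prod_mul_distrib]
  refine prod_congr rfl fun i _ => ?_
  ring

theorem qPoch_two_mul (q : ℂ) (a : ℂ) (n : ℕ) :
    qPoch a q (2 * n) = qPoch a (q ^ 2) n * qPoch (a * q) (q ^ 2) n := by
  induction n with
  | zero => simp [qPoch]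
  | succ n ih =>
    rw [show 2 * (n + 1) = 2 * n + 1 + 1 by ring, qPoch_succ, qPoch_succ, qPoch_succ, qPoch_succ, ih]
    ring

theorem choose_two_add (k i : ℕ) : (k + i).choose 2 = k.choose 2 + i.choose 2 + k * i := by
  induction i with
  | zero => simp
  | succ i ih =>
    rw [← add_assoc, Nat.choose_succ_succ' (k + i) 1, Nat.choose_succ_succ' i 1, ih,
      Nat.choose_one_right, Nat.choose_one_right]
    ring

/-- Reversal of the factors, multiplied through by `q^{mi}` to avoid negative powers. For `i > m`
both sides vanish. -/
theorem qPoch_inv_pow {q : ℂ} (h0 : q ≠ 0) (m i : ℕ) :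
    qPoch ((q ^ m)⁻¹) q i * q ^ (m * i) = (-1) ^ i * q ^ (i.choose 2) * qFall q m i := by
  by_cases h : m < i
  · rw [qFall_eq_zero q h, mul_zero,
      show qPoch ((q ^ m)⁻¹) q i = 0 from prod_eq_zero (mem_range.mpr h) (by simp [h0]), zero_mul]
  push Not at h
  induction i with
  | zero => simp [qPoch, qFall]
  | succ i ih =>
    obtain ⟨l, rfl⟩ := Nat.exists_eq_add_of_le h
    have e1 : (i + 1).choose 2 = i + i.choose 2 := by
      rw [Nat.choose_succ_succ' i 1, Nat.choose_one_right]
    have e2 : i + 1 + l - i = l + 1 := by omega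
    rw [qPoch_succ, qFall_succ, e1, e2, Nat.mul_succ,
      pow_add q ((i + 1 + l) * i), pow_add q i, pow_succ (-1 : ℂ)]
    have e3 : (1 - (q ^ (i + 1 + l))⁻¹ * q ^ i) * q ^ (i + 1 + l) =
        -(q ^ i * (1 - q ^ (l + 1))) := by
      field_simp
      ring
    replace ih := ih (by omega)
    generalize qPoch ((q ^ (i + 1 + l))⁻¹) q i = X at *
    generalize (1 - (q ^ (i + 1 + l))⁻¹ * q ^ i) = Y at *
    linear_combination (-(q ^ i * (1 - q ^ (l + 1)))) * ih +
      X * q ^ ((i + 1 + l) * i) * e3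

theorem qPoch_neg_inv_pow {q : ℂ} (h0 : q ≠ 0) (l i : ℕ) :
    qPoch (-(q ^ (l + i))⁻¹) q i * q ^ ((l + i) * i) * qPoch (-q) q l =
      q ^ (i.choose 2) * qPoch (-q) q (l + i) := by
  induction i generalizing l with
  | zero => simp [qPoch]
  | succ i ih =>
    have e1 : (i + 1).choose 2 = i + i.choose 2 := by
      rw [Nat.choose_succ_succ' i 1, Nat.choose_one_right]
    have := ih (l + 1)
    rw [show l + 1 + i = l + (i + 1) by ring] at this
    have e3 : (1 - -(q ^ (l + (i + 1)))⁻¹ * q ^ i) * q ^ (l + (i + 1)) =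
        q ^ i * (1 - -q * q ^ l) := by
      field_simp
      ring
    rw [e1, pow_add q i, qPoch_succ, Nat.mul_succ, pow_add q _ (l + (i + 1))]
    rw [qPoch_succ] at this
    linear_combination q ^ i * this +
      qPoch (-(q ^ (l + (i + 1)))⁻¹) q i * q ^ ((l + (i + 1)) * i) * qPoch (-q) q l * e3

/-- A balanced terminating `₃φ₂` in base `q²` with numerator parameters `G`, `q^{-M}`, `q^{1-M}`.
The parity of `M` decides which of the last two terminates it; telescoping in `M` treats both
parities at once. -/
theorem qFall_sum {q : ℂ} (hq2 : ∀ k, qPoch (q ^ 2) (q ^ 2) k ≠ 0) (s : ℂ) {G : ℂ}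
    (hG : ∀ k, qPoch (G * s) q k ≠ 0) (M : ℕ) :
    ∑ i ∈ range (M + 1), qPoch G (q ^ 2) i * qPoch s (q ^ 2) (M - i) * (-s) ^ i * q ^ (i ^ 2) *
        qFall q M (2 * i) / (qPoch (q ^ 2) (q ^ 2) i * qPoch (G * s * q) (q ^ 2) i) =
      qPoch s q M * qPoch (G * s) (q ^ 2) M / qPoch (G * s) q M := by
  have hG' : ∀ k, qPoch (G * s * q) (q ^ 2) k ≠ 0 := fun k => by
    have := hG (2 * k)
    rw [qPoch_two_mul] at this
    exact right_ne_zero_of_mul this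
  induction M with
  | zero => simp [qPoch, qFall]
  | succ M ih =>
    let T : ℕ → ℕ → ℂ := fun M i => qPoch G (q ^ 2) i * qPoch s (q ^ 2) (M - i) * (-s) ^ i *
      q ^ (i ^ 2) * qFall q M (2 * i) / (qPoch (q ^ 2) (q ^ 2) i * qPoch (G * s * q) (q ^ 2) i)
    -- Telescoping certificate for the recurrence in `M` stated in `step`, again with value `0` at
    -- index `0`.
    let R : ℕ → ℂ := fun i => Nat.casesOn i 0 fun i =>
      q ^ M * s * qPoch G (q ^ 2) (i + 1) * qPoch s (q ^ 2) (M - i) * (-s) ^ i *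
      q ^ (i ^ 2) * qFall q M (2 * i + 1) /
        (qPoch (q ^ 2) (q ^ 2) i * qPoch (G * s * q) (q ^ 2) i)
    have R_zero : R 0 = 0 := rfl
    have R_succ : ∀ i, R (i + 1) = q ^ M * s * qPoch G (q ^ 2) (i + 1) *
      qPoch s (q ^ 2) (M - i) * (-s) ^ i * q ^ (i ^ 2) * qFall q M (2 * i + 1) /
        (qPoch (q ^ 2) (q ^ 2) i * qPoch (G * s * q) (q ^ 2) i) := fun _ => rfl
    clear_value R
    have step : ∀ i ∈ range (M + 1), (1 - G * s * q ^ M) * T (M + 1) i =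
        (1 - s * q ^ M) * (1 - G * s * q ^ (2 * M)) * T M i + (R (i + 1) - R i) := by
      intro i hi
      cases i with
      | zero =>
        rw [R_zero, R_succ]
        simp only [T, qFall_succ, qFall_zero, qPoch_succ, qPoch_zero, Nat.sub_zero, mul_zero]
        simp
        ring
      | succ k =>
        rw [R_succ, R_succ]
        simp only [T]
        by_cases hk : 2 * k + 1 ≤ M
        · obtain ⟨m, rfl⟩ := Nat.exists_eq_add_of_le hk
          have e1 : 2 * k + 1 + m + 1 - (k + 1) = k + m + 1 := by omega
          have e2 : 2 * k + 1 + m - (k + 1) = k + m := by omega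
          have e3 : 2 * k + 1 + m - k = k + m + 1 := by omega
          have e4 : qFall q (2 * k + 1 + m) (2 * (k + 1) + 1) =
              qFall q (2 * k + 1 + m) (2 * k + 1) * (1 - q ^ m) * (1 - q ^ (m - 1)) := by
            rw [show 2 * (k + 1) + 1 = 2 * k + 1 + 1 + 1 by ring, qFall_succ, qFall_succ,
              show 2 * k + 1 + m - (2 * k + 1) = m by omega,
              show 2 * k + 1 + m - (2 * k + 1 + 1) = m - 1 by omega]
          have e5 : qFall q (2 * k + 1 + m) (2 * (k + 1)) =
              qFall q (2 * k + 1 + m) (2 * k + 1) * (1 - q ^ m) := by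
            rw [show 2 * (k + 1) = 2 * k + 1 + 1 by ring, qFall_succ,
              show 2 * k + 1 + m - (2 * k + 1) = m by omega]
          have e6 : qFall q (2 * k + 1 + m + 1) (2 * (k + 1)) =
              (1 - q ^ (2 * k + 1 + m + 1)) * qFall q (2 * k + 1 + m) (2 * k + 1) := by
            rw [show 2 * (k + 1) = 2 * k + 1 + 1 by ring, qFall_succ_succ]
          have n1 := hq2 (k + 1)
          have n2 := hG' (k + 1)
          rw [qPoch_succ] at n1 n2
          have n3 := left_ne_zero_of_mul n1
          have n4 := right_ne_zero_of_mul n1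
          have n5 := left_ne_zero_of_mul n2
          have n6 := right_ne_zero_of_mul n2
          rw [e1, e2, e3, e4, e5, e6]
          simp only [qPoch_succ]
          generalize qFall q (2 * k + 1 + m) (2 * k + 1) = F
          -- The truncated exponent `m - 1` is harmless at `m = 0`, where the factor `1 - q ^ m`
          -- vanishes.
          rcases m with _ | m
          · simp only [pow_zero, sub_self, mul_zero, zero_mul, zero_div]
            field_simp
            ring
          · rw [Nat.add_sub_cancel]
            field_simp
            ring
        · push Not at hk
          rw [qFall_eq_zero q (show M < 2 * (k + 1) by omega),
            qFall_eq_zero q (show M < 2 * (k + 1) + 1 by omega),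
            qFall_eq_zero q (show M < 2 * k + 1 by omega),
            qFall_eq_zero q (show M + 1 < 2 * (k + 1) by omega)]
          simp
    have last : (1 - G * s * q ^ M) * T (M + 1) (M + 1) = -R (M + 1) := by
      rw [R_succ]
      simp only [T]
      rw [qFall_eq_zero q (show M + 1 < 2 * (M + 1) by omega),
        qFall_eq_zero q (show M < 2 * M + 1 by omega)]
      simp
    have key : (1 - G * s * q ^ M) * ∑ i ∈ range (M + 1 + 1), T (M + 1) i =
        (1 - s * q ^ M) * (1 - G * s * q ^ (2 * M)) * ∑ i ∈ range (M + 1), T M i := by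
      rw [sum_range_succ, mul_add, last, mul_sum, sum_congr rfl step, sum_add_distrib,
        sum_range_sub, ← mul_sum]
      simp [R_zero]
    have h5 := hG (M + 1)
    rw [qPoch_succ] at h5
    have h6 := left_ne_zero_of_mul h5
    have h7 := right_ne_zero_of_mul h5
    refine mul_left_cancel₀ h7 (key.trans ?_)
    rw [show ∑ i ∈ range (M + 1), T M i = _ from ih]
    simp only [qPoch_succ, ← pow_mul]
    generalize 1 - G * s * q ^ M = X at *
    field_simp

/-- A quadratic transformation between two terminating balanced `₄φ₃` series with bases `q`
and `q²` (Singh's transformation in reversed form). -/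
theorem singh_transformation {q : ℂ} (h0 : q ≠ 0) (hq2 : ∀ k, qPoch (q ^ 2) (q ^ 2) k ≠ 0)
    {g s w : ℂ} (hgs : ∀ k, qPoch (g * s) q k ≠ 0) (hw : ∀ k, qPoch (q * w) q k ≠ 0) (n : ℕ) :
    qPoch q q n * qPoch (g * s) (q ^ 2) n * ∑ j ∈ range (n + 1),
      qPoch g (q ^ 2) j * qPoch (-(q ^ (n + 1) * w)) q j * qPoch s q (n - j) * s ^ j /
        (qPoch q q j * qPoch q q (n - j) * qPoch (q * w) q j * qPoch (g * s * q ^ n) q j) =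
    qPoch (q ^ 2) (q ^ 2) n * qPoch (g * s) q n * ∑ j ∈ range (n + 1),
      qPoch g (q ^ 2) j * qPoch (-(q ^ (j + 1) * w)) q j * qPoch s (q ^ 2) (n - j) * s ^ j /
        (qPoch (q ^ 2) (q ^ 2) j * qPoch (q ^ 2) (q ^ 2) (n - j) * qPoch (q * w) q j *
          qPoch (g * s * q) (q ^ 2) j) := by
  have hq : ∀ k, qPoch q q k ≠ 0 := fun k => by
    have := hq2 k
    rw [qPoch_sq_base] at this
    exact left_ne_zero_of_mul this
  have hnq : ∀ k, qPoch (-q) q k ≠ 0 := fun k => by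
    have := hq2 k
    rw [qPoch_sq_base] at this
    exact right_ne_zero_of_mul this
  -- The quotient `(-q^{j+1}w; q)_j / (qw; q)_j` is expanded in the quotients `(-q^{n+1}w; q)_k /
  -- (qw; q)_k`, through which alone the left-hand sum depends on `w`.
  have expand : ∀ j ∈ range (n + 1),
      qPoch g (q ^ 2) j * qPoch (-(q ^ (j + 1) * w)) q j * qPoch s (q ^ 2) (n - j) * s ^ j /
        (qPoch (q ^ 2) (q ^ 2) j * qPoch (q ^ 2) (q ^ 2) (n - j) * qPoch (q * w) q j *
          qPoch (g * s * q) (q ^ 2) j) =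
      ∑ k ∈ range (j + 1), qPoch (-(q ^ (n + 1) * w)) q k * s ^ j * qPoch g (q ^ 2) j *
        qPoch s (q ^ 2) (n - j) * (-1) ^ (j - k) * q ^ ((j - k) ^ 2) *
        qFall q (n - k) (2 * (j - k)) / (qPoch q q k * qPoch q q (n - k) * qPoch (-q) q n *
          qPoch (q ^ 2) (q ^ 2) (j - k) * qPoch (q * w) q k * qPoch (g * s * q) (q ^ 2) j) := by
    intro j hj
    obtain ⟨m, rfl⟩ := Nat.exists_eq_add_of_le (Nat.lt_succ_iff.mp (mem_range.mp hj))
    -- Here `n = j + m`. The parameters are `-q^{n+1}w`, `-q^{-j}` and `q^{-m}`, whose product is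
    -- `qw`.
    have hS := qPfaffSaalschutz hq (-(q ^ (j + m + 1) * w)) (-(q ^ j)⁻¹) (q ^ m)⁻¹ (q * w)
      (by field_simp; ring) j
    rw [show -(q ^ (j + m + 1) * w) * (q ^ m)⁻¹ = -(q ^ (j + 1) * w) by
        rw [show j + m + 1 = m + (j + 1) by ring, pow_add]; field_simp,
      show -(q ^ j)⁻¹ * (q ^ m)⁻¹ = -(q ^ (m + j))⁻¹ by rw [pow_add, mul_inv]; ring] at hS
    have hE := qPoch_neg_inv_pow h0 m j
    have p0 : ∀ k, q ^ k ≠ 0 := fun k => pow_ne_zero k h0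
    have hE0 : qPoch (-(q ^ (m + j))⁻¹) q j ≠ 0 := fun h => by
      rw [h, zero_mul, zero_mul] at hE
      exact mul_ne_zero (p0 _) (hnq _) hE.symm
    rw [eq_div_iff (hq j), eq_comm, ← eq_div_iff hE0] at hS
    rw [hS, Nat.add_sub_cancel_left, sum_mul, sum_div, mul_sum, sum_mul, sum_mul, sum_div]
    refine sum_congr rfl fun k hk => ?_
    obtain ⟨i, rfl⟩ := Nat.exists_eq_add_of_le (Nat.lt_succ_iff.mp (mem_range.mp hk))
    have hK := qPoch_neg_inv_pow h0 i k
    have hI := qPoch_inv_pow h0 m i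
    have hF := qFall_mul_qPoch q m i
    have hF2 := qFall_add q (m + i) i i
    rw [Nat.add_sub_cancel, ← two_mul] at hF2
    rw [← eq_div_iff (hq m)] at hF
    rw [show i + k = k + i by ring] at hK
    rw [show k + i + m - k = m + i by omega, Nat.add_sub_cancel_left, hF2, hF,
      qPoch_add (q * w), show k + i + m = m + (k + i) by ring]
    rw [← eq_div_iff (hnq i), ← eq_div_iff (p0 _)] at hK
    rw [← eq_div_iff (p0 _)] at hI
    rw [← eq_div_iff (hnq m), ← eq_div_iff (p0 _)] at hE
    have hw' := hw (k + i)
    rw [qPoch_add] at hw'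
    rw [hK, hI, hE, choose_two_add, qPoch_sq_base q q (k + i), qPoch_sq_base q q m,
      qPoch_sq_base q q i]
    have n1 := left_ne_zero_of_mul hw'
    have n2 := right_ne_zero_of_mul hw'
    have n3 := hq i
    have n4 := hq k
    have n5 := hq m
    have n6 := hq (k + i)
    have n7 := hq (m + i)
    have n8 := hnq i
    have n9 := hnq m
    have n10 := hnq (k + i)
    have n11 := hnq (m + (k + i))
    rw [inv_pow]
    generalize qPoch (q * w * q ^ k) q i = Y at *
    generalize qPoch (g * s * q) (q ^ 2) (k + i) = Z
    field_simp
    ring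
  rw [sum_congr rfl expand, sum_comm' (t' := range (n + 1)) (s' := fun r => Ico r (n + 1))
    (by intro x y; simp only [mem_range, mem_Ico]; omega), mul_sum, mul_sum]
  -- After the interchange the two sides are compared term by term in `k`; the inner sum is
  -- `qFall_sum` with `G = g q^{2k}` and `M = n - k`.
  refine sum_congr rfl fun k hk => ?_
  obtain ⟨M, rfl⟩ := Nat.exists_eq_add_of_le (Nat.lt_succ_iff.mp (mem_range.mp hk))
  have hgs2 : ∀ k, qPoch (g * s) (q ^ 2) k * qPoch (g * s * q) (q ^ 2) k ≠ 0 := fun k => by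
    have := hgs (2 * k)
    rwa [qPoch_two_mul] at this
  have hG : ∀ l, qPoch (g * (q ^ 2) ^ k * s) q l ≠ 0 := fun l => by
    have := hgs (2 * k + l)
    rw [qPoch_add] at this
    rw [← pow_mul, mul_right_comm]
    exact right_ne_zero_of_mul this
  have hQ := qFall_sum hq2 s hG M
  -- Two factorizations of `(gs; q)_{2k+M}`: cut at `k + M`, or cut at `2k` with the first piece
  -- split into base `q²`.
  have e1 := qPoch_add (g * s) q (k + M) k
  rw [show k + M + k = 2 * k + M by ring, qPoch_add, qPoch_two_mul, pow_mul,
    mul_right_comm g s ((q ^ 2) ^ k)] at e1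
  have e2 := qPoch_add (g * s) (q ^ 2) k M
  rw [mul_right_comm] at e2
  rw [sum_Ico_eq_sum_range, show k + M + 1 - k = M + 1 by omega, Nat.add_sub_cancel_left]
  have n0 := hgs (k + M + k)
  rw [qPoch_add] at n0
  have n1 := right_ne_zero_of_mul n0
  have n2 := hw k
  have n3 := hq k
  have n4 := hq M
  have n5 := hgs2 k
  have n6 := hG M
  have n7 := hq (k + M)
  have n8 := hnq (k + M)
  have inner : ∑ i ∈ range (M + 1), qPoch (-(q ^ (k + M + 1) * w)) q k * s ^ (k + i) *
        qPoch g (q ^ 2) (k + i) * qPoch s (q ^ 2) (k + M - (k + i)) * (-1) ^ (k + i - k) *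
        q ^ ((k + i - k) ^ 2) * qFall q M (2 * (k + i - k)) /
        (qPoch q q k * qPoch q q M * qPoch (-q) q (k + M) *
          qPoch (q ^ 2) (q ^ 2) (k + i - k) * qPoch (q * w) q k *
          qPoch (g * s * q) (q ^ 2) (k + i)) =
      qPoch (-(q ^ (k + M + 1) * w)) q k * s ^ k * qPoch g (q ^ 2) k /
        (qPoch q q k * qPoch q q M * qPoch (-q) q (k + M) * qPoch (q * w) q k *
          qPoch (g * s * q) (q ^ 2) k) *
      (qPoch s q M * qPoch (g * (q ^ 2) ^ k * s) (q ^ 2) M / qPoch (g * (q ^ 2) ^ k * s) q M) := by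
    rw [← hQ, mul_sum]
    refine sum_congr rfl fun i hi => ?_
    have e3 : g * s * q * (q ^ 2) ^ k = g * (q ^ 2) ^ k * s * q := by ring
    rw [show k + M - (k + i) = M - i by omega, Nat.add_sub_cancel_left, qPoch_add g,
      qPoch_add (g * s * q), e3, neg_pow s, pow_add s]
    simp only [div_eq_mul_inv, mul_inv]
    ring
  rw [inner, e2, qPoch_sq_base]
  have n9 := left_ne_zero_of_mul n5
  have n10 := right_ne_zero_of_mul n5
  generalize qPoch (g * s * q ^ (k + M)) q k = X1 at *
  generalize qPoch (g * (q ^ 2) ^ k * s) q M = X2 at *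
  generalize qPoch (g * (q ^ 2) ^ k * s) (q ^ 2) M = X3 at *
  generalize qPoch (g * s * q) (q ^ 2) k = X4 at *
  generalize qPoch (g * s) (q ^ 2) k = X5 at *
  generalize qPoch (g * s) q (k + M) = X6 at *
  field_simp
  linear_combination (X3 * qPoch g (q ^ 2) k * qPoch (-(q ^ (k + M + 1) * w)) q k * qPoch s q M *
    s ^ k) * e1

/-! ### Analytic properties of the infinite `q`-shifted factorial. -/

theorem summable_norm_mul_pow (a : ℂ) {q : ℂ} (hq : ‖q‖ < 1) :
    Summable fun i : ℕ => ‖-(a * q ^ i)‖ := by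
  simp only [norm_neg, norm_mul, norm_pow]
  exact (summable_geometric_of_lt_one (norm_nonneg q) hq).mul_left ‖a‖

theorem tendsto_qPoch (a : ℂ) {q : ℂ} (hq : ‖q‖ < 1) :
    Filter.Tendsto (qPoch a q) Filter.atTop (nhds (qPochInf a q)) :=
  (multipliable_qPochInf a q hq).hasProd.tendsto_prod_nat

theorem qPochInf_eq_qPoch_mul (a : ℂ) {q : ℂ} (hq : ‖q‖ < 1) (n : ℕ) :
    qPochInf a q = qPoch a q n * qPochInf (a * q ^ n) q := by
  refine tendsto_nhds_unique ((Filter.tendsto_add_atTop_iff_nat n).mpr (tendsto_qPoch a hq)) ?_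
  simp only [add_comm _ n, qPoch_add]
  exact (tendsto_qPoch (a * q ^ n) hq).const_mul _

theorem qPochInf_ne_zero {a q : ℂ} (hq : ‖q‖ < 1) (h : ∀ n : ℕ, a * q ^ n ≠ 1) :
    qPochInf a q ≠ 0 := by
  have := tprod_one_add_ne_zero_of_summable (f := fun i : ℕ => -(a * q ^ i))
    (fun i => by rw [← sub_eq_add_neg]; exact sub_ne_zero.mpr (h i).symm)
    (summable_norm_mul_pow a hq)
  simpa only [← sub_eq_add_neg, qPochInf] using this

theorem qPochInf_two_step (a : ℂ) {q : ℂ} (hq : ‖q‖ < 1) :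
    qPochInf a q = qPochInf a (q ^ 2) * qPochInf (a * q) (q ^ 2) := by
  have hq2 : ‖q ^ 2‖ < 1 := by
    rw [norm_pow]; exact pow_lt_one₀ (norm_nonneg q) hq two_ne_zero
  have h2 : Filter.Tendsto (fun n : ℕ => 2 * n) Filter.atTop Filter.atTop :=
    Filter.tendsto_id.const_mul_atTop' two_pos
  refine tendsto_nhds_unique ((tendsto_qPoch a hq).comp h2) ?_
  simp only [Function.comp_def, qPoch_two_mul]
  exact (tendsto_qPoch a hq2).mul (tendsto_qPoch (a * q) hq2)

theorem norm_qPoch_le (a : ℂ) {q : ℂ} (hq : ‖q‖ < 1) (n : ℕ) :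
    ‖qPoch a q n‖ ≤ Real.exp (‖a‖ / (1 - ‖q‖)) := by
  calc ‖qPoch a q n‖ ≤ ∏ i ∈ range n, Real.exp (‖a‖ * ‖q‖ ^ i) := by
        rw [qPoch, norm_prod]
        refine prod_le_prod (fun _ _ => norm_nonneg _) fun i _ => ?_
        calc ‖1 - a * q ^ i‖ ≤ ‖(1 : ℂ)‖ + ‖a * q ^ i‖ := norm_sub_le _ _
          _ = ‖a‖ * ‖q‖ ^ i + 1 := by rw [norm_one, norm_mul, norm_pow, add_comm]
          _ ≤ _ := Real.add_one_le_exp _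
    _ = Real.exp (‖a‖ * ∑ i ∈ range n, ‖q‖ ^ i) := by rw [← Real.exp_sum, mul_sum]
    _ ≤ _ := by
        rw [div_eq_mul_inv, ← tsum_geometric_of_lt_one (norm_nonneg q) hq]
        gcongr
        exact (summable_geometric_of_lt_one (norm_nonneg q) hq).sum_le_tsum _
          fun i _ => by positivity

theorem norm_qPochInf_le (a : ℂ) {q : ℂ} (hq : ‖q‖ < 1) :
    ‖qPochInf a q‖ ≤ Real.exp (‖a‖ / (1 - ‖q‖)) :=
  le_of_tendsto (tendsto_qPoch a hq).norm (Filter.Eventually.of_forall (norm_qPoch_le a hq))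

theorem norm_qPoch_inv_bounded {a q : ℂ} (hq : ‖q‖ < 1) (h : ∀ n : ℕ, a * q ^ n ≠ 1) :
    ∃ C, ∀ n, ‖(qPoch a q n)⁻¹‖ ≤ C := by
  obtain ⟨C, hC⟩ := (((tendsto_qPoch a hq).inv₀ (qPochInf_ne_zero hq h)).norm).bddAbove_range
  exact ⟨C, fun n => hC ⟨n, rfl⟩⟩

theorem differentiable_qPoch (q : ℂ) (n : ℕ) : Differentiable ℂ fun a => qPoch a q n := by
  unfold qPoch
  fun_prop

theorem differentiable_qPochInf {q : ℂ} (hq : ‖q‖ < 1) :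
    Differentiable ℂ fun a => qPochInf a q := by
  intro a₀
  have hu : Summable fun i : ℕ => (‖a₀‖ + 1) * ‖q‖ ^ i :=
    (summable_geometric_of_lt_one (norm_nonneg q) hq).mul_left _
  have hP := Summable.hasProdLocallyUniformlyOn_nat_one_add (f := fun i a => -(a * q ^ i))
    (K := Metric.ball 0 (‖a₀‖ + 1)) Metric.isOpen_ball hu
    (Filter.Eventually.of_forall fun i a ha => by
      rw [norm_neg, norm_mul, norm_pow]
      gcongr
      exact (mem_ball_zero_iff.mp ha).le)
    (fun i => by fun_prop)
  have hD := (hP.tendstoLocallyUniformlyOn_finsetRange).differentiableOn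
    (Filter.Eventually.of_forall fun n => by fun_prop) Metric.isOpen_ball
  have := hD.differentiableAt (Metric.isOpen_ball.mem_nhds
    (mem_ball_zero_iff.mpr (lt_add_one ‖a₀‖)))
  simpa only [← sub_eq_add_neg, qPochInf] using this

/-! ### The terminating case. -/

/-- The terms are symmetric in the numerator parameters; this and the next permutation produce the
order required by `W87_watson`. -/
theorem W87Term_rotate (a f b c d e q u : ℂ) :
    W87Term ![a, f, c, d, e, b] q u = W87Term ![a, f, b, c, d, e] q u := by
  funext r
  simp only [W87Term, Fin.prod_univ_six, Matrix.cons_val]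
  ring

theorem W87Term_permute (a f b c d e q u : ℂ) :
    W87Term ![a, f, d, b, e, c] q u = W87Term ![a, f, b, c, d, e] q u := by
  funext r
  simp only [W87Term, Fin.prod_univ_six, Matrix.cons_val]
  ring

/-- Reversal turns `1/((q; q)_{n-r} (aq; q)_{n+r})` in `watson_transformation` into the pair
`(q^{-n}; q)_r / (aq^{n+1}; q)_r`, absorbing the sign and the power of `q` from the unit Bailey
pair. -/
theorem W87_watson {a q b c t d e s : ℂ} (h0 : q ≠ 0) (hq : ∀ k, qPoch q q k ≠ 0)
    (ha0 : a ≠ 0) (ha : a ≠ 1)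
    (haq : ∀ k, qPoch (a * q) q k ≠ 0) (hds : ∀ k, qPoch (d * s) q k ≠ 0)
    (hes : ∀ k, qPoch (e * s) q k ≠ 0) (hs : a * q = d * e * s)
    (hbt : ∀ k, qPoch (b * t) q k ≠ 0) (hct : ∀ k, qPoch (c * t) q k ≠ 0)
    (ht : a * q = b * c * t) (n : ℕ) :
    W87 ![a, (q ^ n)⁻¹, b, c, d, e] q (s * t * q ^ n) =
      qPoch (a * q) q n * qPoch q q n / (qPoch (d * s) q n * qPoch (e * s) q n) *
      ∑ j ∈ range (n + 1), qPoch d q j * qPoch e q j * qPoch s q (n - j) * s ^ j /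
        qPoch q q (n - j) * (qPoch t q j / (qPoch q q j * qPoch (b * t) q j *
          qPoch (c * t) q j)) := by
  have hd : d ≠ 0 := by rintro rfl; simp [ha0, h0] at hs
  have he : e ≠ 0 := by rintro rfl; simp [ha0, h0] at hs
  have hb : b ≠ 0 := by rintro rfl; simp [ha0, h0] at ht
  have hc : c ≠ 0 := by rintro rfl; simp [ha0, h0] at ht
  have hW := watson_transformation hq ha haq hds hes hs hbt hct ht n
  rw [W87, tsum_eq_sum (s := range (n + 1)), div_mul_eq_mul_div, mul_div_assoc, ← hW, mul_sum]
  · refine sum_congr rfl fun r hr => ?_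
    obtain ⟨m, rfl⟩ := Nat.exists_eq_add_of_le (Nat.lt_succ_iff.mp (mem_range.mp hr))
    have e1 : q * a / d = e * s := by rw [mul_comm, hs]; field_simp
    have e2 : q * a / e = d * s := by rw [mul_comm, hs]; field_simp
    have e3 : q * a / b = c * t := by rw [mul_comm, ht]; field_simp
    have e4 : q * a / c = b * t := by rw [mul_comm, ht]; field_simp
    have e5 : q * a / a = q := by field_simp
    have e6 : q * a / (q ^ (r + m))⁻¹ = a * q * q ^ (r + m) := by
      rw [div_inv_eq_mul]; ring
    have hI := qPoch_inv_pow h0 (r + m) r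
    rw [← eq_div_iff (pow_ne_zero _ h0)] at hI
    have hF := qFall_mul_qPoch q m r
    rw [add_comm m r, ← eq_div_iff (hq m)] at hF
    have n0 := haq (r + m + r)
    rw [qPoch_add] at n0
    simp only [W87Term, Fin.prod_univ_six, Matrix.cons_val, e1, e2, e3, e4, e5, e6, hI, hF,
      Nat.add_sub_cancel_left]
    rw [qPoch_add (a * q) q (r + m) r]
    have n1 := left_ne_zero_of_mul n0
    have n2 := right_ne_zero_of_mul n0
    have n3 := hq m
    have n4 := hq r
    have n5 := hq (r + m)
    have n6 := hds r
    have n7 := hes r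
    have n8 := hbt r
    have n9 := hct r
    have n10 : q ^ ((r + m) * r) ≠ 0 := pow_ne_zero _ h0
    have n11 : 1 - a ≠ 0 := sub_ne_zero.mpr ha.symm
    rw [mul_pow (s * t), ← pow_mul, mul_pow s]
    generalize q ^ ((r + m) * r) = Y at *
    generalize qPoch (a * q * q ^ (r + m)) q r = Z at *
    generalize qPoch (a * q) q (r + m) = Z2 at *
    generalize qPoch (d * s) q r = X1 at *
    generalize qPoch (e * s) q r = X2 at *
    generalize qPoch (b * t) q r = X3 at *
    generalize qPoch (c * t) q r = X4 at *
    generalize qPoch q q r = X5 at *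
    generalize qPoch q q m = X6 at *
    generalize qPoch q q (r + m) = X7 at *
    generalize qPoch a q r = X8
    generalize qPoch b q r = X9
    generalize qPoch c q r = X10
    generalize qPoch d q r = X11
    generalize qPoch e q r = X12
    generalize 1 - a * q ^ (2 * r) = X13
    generalize 1 - a = X14 at *
    clear hI hF hW n0 e1 e2 e3 e4 e5 e6
    field_simp
  · intro r hr
    have : qPoch (q ^ n)⁻¹ q r = 0 :=
      prod_eq_zero (mem_range.mpr (Nat.succ_le_iff.mp (not_lt.mp (mem_range.not.mp hr))))
        (by simp [h0])
    simp [W87Term, Fin.prod_univ_six, this]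

theorem qPoch_shift_ne_zero {a b q : ℂ} (m : ℕ) (hb : b = a * q ^ m)
    (h : ∀ n : ℕ, a * q ^ n ≠ 1) (n : ℕ) : qPoch b q n ≠ 0 :=
  qPoch_ne_zero (fun k => by rw [hb, mul_assoc, ← pow_add]; exact h _) n

/-- The quadratic transformation in the terminating case `α = z q^{n+1}`. -/
theorem quadratic_transformation_terminating {p Q x z α β : ℂ} {n : ℕ} (hQ1 : ‖Q‖ < 1)
    (hp2 : p ^ 2 = Q) (h0 : Q ≠ 0) (hx : x ≠ 0) (hz : z ≠ 0) (hβ : β ≠ 0)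
    (hα : α = z * Q ^ (n + 1))
    (h1 : ∀ n : ℕ, Q * β * x * z * Q ^ n ≠ 1)
    (h2 : ∀ n : ℕ, -(Q * x * z / β) * Q ^ n ≠ 1)
    (h3 : ∀ n : ℕ, p ^ 3 * x * z / α * Q ^ n ≠ 1)
    (h4 : ∀ n : ℕ, -(p * α * x * z) * Q ^ n ≠ 1)
    (h5 : ∀ n : ℕ, Q * z ^ 2 * Q ^ n ≠ 1)
    (h6 : ∀ n : ℕ, -(p * x * z ^ 2) * Q ^ n ≠ 1)
    (h7 : ∀ n : ℕ, Q ^ 2 * β * x * z ^ 2 / α * Q ^ n ≠ 1)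
    (h8 : ∀ n : ℕ, -(Q ^ 2 * x * z ^ 2 / (α * β)) * (Q ^ 2) ^ n ≠ 1)
    (h9 : ∀ n : ℕ, -(Q * α * β * x * z ^ 2) * (Q ^ 2) ^ n ≠ 1)
    (h10 : ∀ n : ℕ, Q ^ 2 * z ^ 4 * (Q ^ 2) ^ n ≠ 1)
    (h11 : ∀ n : ℕ, -(Q * β * x * z ^ 4 / α) * (Q ^ 2) ^ n ≠ 1)
    (hL : ‖p * x‖ < 1) :
    qPochInfs [Q * β * x * z, -(Q * x * z / β), p ^ 3 * x * z / α, -(p * α * x * z)] Q /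
        qPochInfs [p * x, -(p ^ 3 * x * z ^ 2), Q ^ 2 * β * x * z ^ 2 / α] Q *
      W87 ![-(p * x * z ^ 2), Q * z / α, -(p * z / β), -(α * z), p * β * z, -(p * x)]
        Q (-(p * x)) =
    qPochInfs [-(Q ^ 2 * x * z ^ 2 / (α * β)), -(Q * α * β * x * z ^ 2), -(Q * α * x / β)]
          (Q ^ 2) /
        qPochInfs [-(Q ^ 3 * β * x * z ^ 4 / α)] (Q ^ 2) *
      W87 ![-(Q * β * x * z ^ 4 / α), Q ^ 2 * z ^ 2 / α ^ 2, -(Q * z ^ 2), -z ^ 2,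
          Q * β ^ 2 * z ^ 2, -(Q * β * x / α)]
        (Q ^ 2) (-(Q * α * x / β)) := by
  have hp0 : p ≠ 0 := by rintro rfl; exact h0 (by rw [← hp2]; simp)
  have hn0 : Q ^ n ≠ 0 := pow_ne_zero n h0
  have hα0 : α ≠ 0 := by rw [hα]; exact mul_ne_zero hz (pow_ne_zero _ h0)
  have hQ2 : ‖Q ^ 2‖ < 1 := by
    rw [norm_pow]; exact pow_lt_one₀ (norm_nonneg Q) hQ1 two_ne_zero
  have hQ2n : ∀ n : ℕ, Q ^ 2 * (Q ^ 2) ^ n ≠ 1 := fun n h => by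
    have h' := congrArg norm h
    rw [← pow_succ', norm_pow, norm_one] at h'
    exact (pow_lt_one₀ (norm_nonneg _) hQ2 (Nat.succ_ne_zero n)).ne h'
  have hq2 := qPoch_ne_zero hQ2n
  have hq : ∀ k, qPoch Q Q k ≠ 0 := fun k => by
    have := hq2 k
    rw [qPoch_sq_base] at this
    exact left_ne_zero_of_mul this
  have hpx : ∀ n : ℕ, p * x * Q ^ n ≠ 1 := fun n h => by
    have h' := congrArg norm h
    rw [norm_mul, norm_pow, norm_one] at h'
    have := mul_le_mul_of_nonneg_left (pow_le_one₀ (norm_nonneg Q) hQ1.le (n := n))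
      (norm_nonneg (p * x))
    linarith
  obtain ⟨g, hg⟩ : ∃ g, g = Q * β ^ 2 * z ^ 2 := ⟨_, rfl⟩
  -- This is `Qx/(αβ)`, the common value of `aq/(de)` in base `Q` on the left and of its analogue in
  -- base `Q²` on the right. That the two coincide is what lets a single Singh transformation link
  -- them.
  obtain ⟨s, hs⟩ : ∃ s, s = x / (Q ^ n * (β * z)) := ⟨_, rfl⟩
  have hgs : g * s = Q ^ 2 * β * x * z ^ 2 / α := by
    rw [hg, hs, hα]; field_simp; ring
  have hgsn : ∀ k, qPoch (g * s) Q k ≠ 0 := by rw [hgs]; exact qPoch_ne_zero h7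
  have hgs2 : ∀ k, qPoch (g * s) (Q ^ 2) k ≠ 0 ∧ qPoch (g * s * Q) (Q ^ 2) k ≠ 0 := fun k => by
    have := hgsn (2 * k)
    rw [qPoch_two_mul] at this
    exact ⟨left_ne_zero_of_mul this, right_ne_zero_of_mul this⟩
  have hS := singh_transformation h0 hq2 (g := g) (s := s) (w := z ^ 2) hgsn
    (qPoch_ne_zero h5) n

  have hWL := W87_watson (a := -(p * x * z ^ 2)) (q := Q) (b := -(p * x)) (c := -(p * z / β))
    (t := -(p * β * z)) (d := -(α * z)) (e := p * β * z) (s := s) h0 hq (by simp [hp0, hx, hz])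
    (by simpa using h6 0) (qPoch_shift_ne_zero 1 (by ring) h6)
    (qPoch_shift_ne_zero 0 (by rw [hs, hα]; field_simp; ring) h2)
    (qPoch_shift_ne_zero 0 (by rw [hs, hα, ← hp2]; field_simp; ring) h3)
    (by rw [hs, hα]; field_simp; ring)
    (qPoch_shift_ne_zero 0 (by rw [← hp2]; ring) h1)
    (qPoch_shift_ne_zero 0 (by rw [← hp2]; field_simp) h5)
    (by rw [← hp2]; field_simp) n

  have hWR := W87_watson (a := -(Q * β * x * z ^ 4 / α)) (q := Q ^ 2) (b := -z ^ 2)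
    (c := -(Q * β * x / α)) (t := -(Q ^ 2 * z ^ 2)) (d := -(Q * z ^ 2)) (e := g) (s := s)
    (pow_ne_zero 2 h0) hq2 (by simp [h0, hβ, hx, hz, hα0])
    (by simpa using h11 0) (qPoch_shift_ne_zero 1 (by ring) h11)
    (qPoch_shift_ne_zero 0 (by rw [hs, hα]; field_simp; ring) h8)
    (fun k => (hgs2 k).1)
    (by rw [hs, hg, hα]; field_simp; ring)
    (qPoch_shift_ne_zero 0 (by ring) h10)
    (fun k => by
      rw [show -(Q * β * x / α) * -(Q ^ 2 * z ^ 2) = g * s * Q by rw [hgs]; ring]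
      exact (hgs2 k).2)
    (by field_simp) n
  have hSL : ∑ j ∈ range (n + 1), qPoch (-(α * z)) Q j * qPoch (p * β * z) Q j *
        qPoch s Q (n - j) * s ^ j / qPoch Q Q (n - j) * (qPoch (-(p * β * z)) Q j / (qPoch Q Q j *
          qPoch (-(p * x) * -(p * β * z)) Q j * qPoch (-(p * z / β) * -(p * β * z)) Q j)) =
      ∑ j ∈ range (n + 1),
        qPoch g (Q ^ 2) j * qPoch (-(Q ^ (n + 1) * z ^ 2)) Q j * qPoch s Q (n - j) * s ^ j /
          (qPoch Q Q j * qPoch Q Q (n - j) * qPoch (Q * z ^ 2) Q j *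
            qPoch (g * s * Q ^ n) Q j) := by
    refine sum_congr rfl fun j _ => ?_
    rw [show g = (p * β * z) ^ 2 by rw [hg, ← hp2]; ring, qPoch_sq_base,
      show (p * β * z) ^ 2 * s * Q ^ n = -(p * x) * -(p * β * z) by rw [hs]; field_simp,
      show -(p * z / β) * -(p * β * z) = Q * z ^ 2 by rw [← hp2]; field_simp,
      show -(Q ^ (n + 1) * z ^ 2) = -(α * z) by rw [hα]; ring]
    simp only [div_eq_mul_inv, mul_inv]
    ring
  have hSR : ∑ j ∈ range (n + 1), qPoch (-(Q * z ^ 2)) (Q ^ 2) j * qPoch g (Q ^ 2) j *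
        qPoch s (Q ^ 2) (n - j) * s ^ j / qPoch (Q ^ 2) (Q ^ 2) (n - j) *
        (qPoch (-(Q ^ 2 * z ^ 2)) (Q ^ 2) j / (qPoch (Q ^ 2) (Q ^ 2) j *
          qPoch (-z ^ 2 * -(Q ^ 2 * z ^ 2)) (Q ^ 2) j *
          qPoch (-(Q * β * x / α) * -(Q ^ 2 * z ^ 2)) (Q ^ 2) j)) =
      ∑ j ∈ range (n + 1),
        qPoch g (Q ^ 2) j * qPoch (-(Q ^ (j + 1) * z ^ 2)) Q j * qPoch s (Q ^ 2) (n - j) * s ^ j /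
          (qPoch (Q ^ 2) (Q ^ 2) j * qPoch (Q ^ 2) (Q ^ 2) (n - j) * qPoch (Q * z ^ 2) Q j *
            qPoch (g * s * Q) (Q ^ 2) j) := by
    refine sum_congr rfl fun j _ => ?_
    -- `(-Qz², -Q²z²; Q²)_j = (-Qz²; Q)_{2j}`, and dividing by `(Q²z⁴; Q²)_j = (Qz², -Qz²; Q)_j`
    -- leaves `(-Q^{j+1}z²; Q)_j / (Qz²; Q)_j`.
    have e1 := qPoch_two_mul Q (-(Q * z ^ 2)) j
    rw [two_mul, qPoch_add, show -(Q * z ^ 2) * Q = -(Q ^ 2 * z ^ 2) by ring,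
      show -(Q * z ^ 2) * Q ^ j = -(Q ^ (j + 1) * z ^ 2) by ring] at e1
    have e2 := qPoch_sq_base Q (Q * z ^ 2) j
    rw [show (Q * z ^ 2) ^ 2 = -z ^ 2 * -(Q ^ 2 * z ^ 2) by ring] at e2
    have n1 : qPoch (-z ^ 2 * -(Q ^ 2 * z ^ 2)) (Q ^ 2) j ≠ 0 :=
      qPoch_shift_ne_zero 0 (by ring) h10 j
    rw [e2] at n1 ⊢
    rw [show -(Q * β * x / α) * -(Q ^ 2 * z ^ 2) = g * s * Q by rw [hgs]; ring]
    have n2 := left_ne_zero_of_mul n1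
    have n3 := right_ne_zero_of_mul n1
    have n4 := hq2 j
    have n5 := hq2 (n - j)
    have n6 := (hgs2 j).2
    generalize qPoch (g * s * Q) (Q ^ 2) j = X1 at *
    generalize qPoch (Q ^ 2) (Q ^ 2) (n - j) = X2 at *
    generalize qPoch (-(Q ^ (j + 1) * z ^ 2)) Q j = X3 at *
    field_simp
    linear_combination (-(qPoch g (Q ^ 2) j * qPoch s (Q ^ 2) (n - j) * s ^ j)) * e1
  rw [hSL] at hWL
  rw [hSR] at hWR
  have hW1 : W87 ![-(p * x * z ^ 2), Q * z / α, -(p * z / β), -(α * z), p * β * z, -(p * x)]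
      Q (-(p * x)) = W87 ![-(p * x * z ^ 2), (Q ^ n)⁻¹, -(p * x), -(p * z / β), -(α * z),
        p * β * z] Q (s * -(p * β * z) * Q ^ n) := by
    rw [W87, W87Term_rotate, W87, show Q * z / α = (Q ^ n)⁻¹ by rw [hα]; field_simp; ring,
      show s * -(p * β * z) * Q ^ n = -(p * x) by rw [hs]; field_simp]
  have hW2 : W87 ![-(Q * β * x * z ^ 4 / α), Q ^ 2 * z ^ 2 / α ^ 2, -(Q * z ^ 2), -z ^ 2,
      Q * β ^ 2 * z ^ 2, -(Q * β * x / α)] (Q ^ 2) (-(Q * α * x / β)) =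
        W87 ![-(Q * β * x * z ^ 4 / α), ((Q ^ 2) ^ n)⁻¹, -z ^ 2, -(Q * β * x / α), -(Q * z ^ 2), g]
          (Q ^ 2) (s * -(Q ^ 2 * z ^ 2) * (Q ^ 2) ^ n) := by
    rw [W87, W87Term_permute, W87, ← hg,
      show Q ^ 2 * z ^ 2 / α ^ 2 = ((Q ^ 2) ^ n)⁻¹ by rw [hα]; field_simp; ring,
      show -(Q * α * x / β) = s * -(Q ^ 2 * z ^ 2) * (Q ^ 2) ^ n by
        rw [hs, hα]; field_simp; ring]
  rw [hW1, hW2, hWL, hWR]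
  -- Infinite products are cut at `n`, so that the tails match across the equation and only finite
  -- products remain. The tail at `-αx/β` has base `Q` on the left, so it is split into two products
  -- of base `Q²`.
  have i1 := qPochInf_eq_qPoch_mul (p * β * z * s) hQ1 n
  rw [show p * β * z * s * Q ^ n = p * x by rw [hs]; field_simp] at i1
  have i2 := qPochInf_eq_qPoch_mul (-(p * x * z ^ 2) * Q) hQ1 n
  rw [show -(p * x * z ^ 2) * Q * Q ^ n = -(p * α * x * z) by rw [hα]; ring] at i2
  have i3 := qPochInf_eq_qPoch_mul (g * s) hQ1 n
  rw [show g * s * Q ^ n = Q * β * x * z by rw [hs, hg]; field_simp] at i3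
  have i4 := qPochInf_eq_qPoch_mul (-(α * z) * s) hQ1 n
  rw [show -(α * z) * s * Q ^ n = -(α * x / β) by rw [hs]; field_simp,
    qPochInf_two_step (-(α * x / β)) hQ1, show -(α * x / β) * Q = -(Q * α * x / β) by ring] at i4
  have i5 := qPochInf_eq_qPoch_mul (-(Q * z ^ 2) * s) hQ2 n
  rw [show -(Q * z ^ 2) * s * (Q ^ 2) ^ n = -(α * x / β) by
    rw [hs, hα]; field_simp; ring] at i5
  have i6 := qPochInf_eq_qPoch_mul (-(Q * β * x * z ^ 4 / α) * Q ^ 2) hQ2 n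
  rw [show -(Q * β * x * z ^ 4 / α) * Q ^ 2 * (Q ^ 2) ^ n = -(Q * α * β * x * z ^ 2) by
    rw [hα]; field_simp; ring] at i6
  simp only [qPochInfs, List.map_cons, List.map_nil, List.prod_cons, List.prod_nil, mul_one]
  rw [show -(Q * x * z / β) = -(α * z) * s by rw [hs, hα]; field_simp; ring,
    show p ^ 3 * x * z / α = p * β * z * s by rw [hs, hα, ← hp2]; field_simp; ring,
    show -(p ^ 3 * x * z ^ 2) = -(p * x * z ^ 2) * Q by rw [← hp2]; ring, ← hgs,
    show -(Q ^ 2 * x * z ^ 2 / (α * β)) = -(Q * z ^ 2) * s by rw [hs, hα]; field_simp; ring,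
    show -(Q ^ 3 * β * x * z ^ 4 / α) = -(Q * β * x * z ^ 4 / α) * Q ^ 2 by ring,
    i1, i2, i3, i4, i5, i6]
  have m1 := qPochInf_ne_zero hQ1 hpx
  have m2 := qPochInf_ne_zero hQ1 h4
  have m3 := qPochInf_ne_zero hQ1 h1
  have m4 := qPochInf_ne_zero hQ2 h9
  have m5 : qPoch (-(p * x * z ^ 2) * Q) Q n ≠ 0 := qPoch_shift_ne_zero 1 (by ring) h6 n
  have m6 : qPoch (-(Q * β * x * z ^ 4 / α) * Q ^ 2) (Q ^ 2) n ≠ 0 :=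
    qPoch_shift_ne_zero 1 (by ring) h11 n
  have m7 : qPoch (-(α * z) * s) Q n ≠ 0 :=
    qPoch_shift_ne_zero 0 (by rw [hs, hα]; field_simp; ring) h2 n
  have m8 : qPoch (p * β * z * s) Q n ≠ 0 :=
    qPoch_shift_ne_zero 0 (by rw [hs, hα, ← hp2]; field_simp; ring) h3 n
  have m9 : qPoch (-(Q * z ^ 2) * s) (Q ^ 2) n ≠ 0 :=
    qPoch_shift_ne_zero 0 (by rw [hs, hα]; field_simp; ring) h8 n
  have m10 := hgsn n
  have m11 := (hgs2 n).1
  clear hWL hWR hSL hSR hW1 hW2 i1 i2 i3 i4 i5 i6 h1 h2 h3 h4 h5 h6 h7 h8 h9 h10 h11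
  generalize ∑ j ∈ range (n + 1), _ / (qPoch Q Q j * _ * _ * _) = SL at *
  generalize ∑ j ∈ range (n + 1), _ / (qPoch (Q ^ 2) (Q ^ 2) j * _ * _ * _) = SR at *
  generalize qPoch (-(α * z) * s) Q n = X1 at *
  generalize qPoch (p * β * z * s) Q n = X2 at *
  generalize qPoch (-(Q * z ^ 2) * s) (Q ^ 2) n = X3 at *
  generalize qPoch (g * s) Q n = X4 at *
  generalize qPoch (g * s) (Q ^ 2) n = X5 at *
  generalize qPoch (-(p * x * z ^ 2) * Q) Q n = X6 at *
  generalize qPoch (-(Q * β * x * z ^ 4 / α) * Q ^ 2) (Q ^ 2) n = X7 at *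
  generalize qPochInf (p * x) Q = Y1 at *
  generalize qPochInf (-(p * α * x * z)) Q = Y2 at *
  generalize qPochInf (Q * β * x * z) Q = Y3 at *
  generalize qPochInf (-(Q * α * β * x * z ^ 2)) (Q ^ 2) = Y4 at *
  generalize qPochInf (-(α * x / β)) (Q ^ 2) = Y5 at *
  generalize qPochInf (-(Q * α * x / β)) (Q ^ 2) = Y6 at *
  generalize qPoch Q Q n = Z1 at *
  generalize qPoch (Q ^ 2) (Q ^ 2) n = Z2 at *
  field_simp
  linear_combination (Y5 * Y6) * hS

/-! ### Domination and holomorphy of the series. -/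

/-- Removes the singularity at `w = 0`: the right-hand side is a polynomial in `w`. -/
theorem qPoch_div_mul_pow (c q : ℂ) {w : ℂ} (hw : w ≠ 0) (r : ℕ) :
    qPoch (c / w) q r * w ^ r = ∏ i ∈ range r, (w - c * q ^ i) := by
  rw [qPoch, ← card_range r, ← prod_const, card_range, ← prod_mul_distrib]
  refine prod_congr rfl fun i _ => ?_
  field_simp

theorem norm_prod_sub_le {c q w : ℂ} {R : ℝ} (hq : ‖q‖ < 1) (hR : 0 < R) (hw : ‖w‖ ≤ R) (r : ℕ) :
    ‖∏ i ∈ range r, (w - c * q ^ i)‖ ≤ R ^ r * Real.exp (‖c‖ / R / (1 - ‖q‖)) := by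
  calc ‖∏ i ∈ range r, (w - c * q ^ i)‖
      ≤ ∏ i ∈ range r, (R * Real.exp (‖c‖ / R * ‖q‖ ^ i)) := by
        rw [norm_prod]
        refine prod_le_prod (fun _ _ => norm_nonneg _) fun i _ => ?_
        calc ‖w - c * q ^ i‖ ≤ ‖w‖ + ‖c * q ^ i‖ := norm_sub_le _ _
          _ ≤ R + ‖c‖ * ‖q‖ ^ i := by rw [norm_mul, norm_pow]; gcongr
          _ = R * (‖c‖ / R * ‖q‖ ^ i + 1) := by field_simp; ring
          _ ≤ _ := by gcongr; exact Real.add_one_le_exp _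
    _ = R ^ r * Real.exp (‖c‖ / R * ∑ i ∈ range r, ‖q‖ ^ i) := by
        rw [prod_mul_distrib, prod_const, card_range, ← Real.exp_sum, mul_sum]
    _ ≤ _ := by
        rw [div_eq_mul_inv _ (1 - ‖q‖), ← tsum_geometric_of_lt_one (norm_nonneg q) hq]
        gcongr
        exact (summable_geometric_of_lt_one (norm_nonneg q) hq).sum_le_tsum _
          fun i _ => by positivity

/-- A sequence of entire functions that is uniformly bounded on the disc of radius `ρ`. -/
def BoundedHolomorphic (ρ : ℝ) (f : ℂ → ℕ → ℂ) : Prop :=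
  (∀ r, Differentiable ℂ fun w => f w r) ∧ ∃ C, ∀ w ∈ Metric.ball (0 : ℂ) ρ, ∀ r, ‖f w r‖ ≤ C

namespace BoundedHolomorphic

variable {ρ : ℝ} {f g : ℂ → ℕ → ℂ} {q : ℂ} {φ : ℂ → ℂ}

theorem mul (hf : BoundedHolomorphic ρ f) (hg : BoundedHolomorphic ρ g) :
    BoundedHolomorphic ρ fun w r => f w r * g w r := by
  obtain ⟨hf, C, hC⟩ := hf
  obtain ⟨hg, D, hD⟩ := hg
  refine ⟨fun r => (hf r).mul (hg r), C * D, fun w hw r => ?_⟩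
  rw [norm_mul]
  exact mul_le_mul (hC w hw r) (hD w hw r) (norm_nonneg _) ((norm_nonneg _).trans (hC w hw r))

theorem const {c : ℕ → ℂ} (hc : ∃ C, ∀ r, ‖c r‖ ≤ C) : BoundedHolomorphic ρ fun _ r => c r :=
  ⟨fun _ => differentiable_const _, hc.imp fun _ hC _ _ r => hC r⟩

theorem exists_bound (hφ : Continuous φ) (ρ : ℝ) :
    ∃ A, ∀ w ∈ Metric.ball (0 : ℂ) ρ, ‖φ w‖ ≤ A := by
  obtain ⟨A, hA⟩ := (isCompact_closedBall (0 : ℂ) ρ).exists_bound_of_continuousOn hφ.continuousOn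
  exact ⟨A, fun w hw => hA w (Metric.ball_subset_closedBall hw)⟩

theorem qPoch (hq : ‖q‖ < 1) (hφ : Differentiable ℂ φ) :
    BoundedHolomorphic ρ fun w r => qPoch (φ w) q r := by
  obtain ⟨A, hA⟩ := exists_bound hφ.continuous ρ
  refine ⟨fun r => (differentiable_qPoch q r).comp hφ, _, fun w hw r =>
    (norm_qPoch_le _ hq r).trans (Real.exp_le_exp.mpr
      (div_le_div_of_nonneg_right (hA w hw) (sub_nonneg.mpr hq.le)))⟩

theorem qPochInf (hq : ‖q‖ < 1) (hφ : Differentiable ℂ φ) :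
    BoundedHolomorphic ρ fun w r => qPochInf (φ w * q ^ r) q := by
  obtain ⟨A, hA⟩ := exists_bound hφ.continuous ρ
  refine ⟨fun r => (differentiable_qPochInf hq).comp (hφ.mul_const _), _, fun w hw r =>
    (norm_qPochInf_le _ hq).trans (Real.exp_le_exp.mpr
      (div_le_div_of_nonneg_right (le_trans ?_ (hA w hw)) (sub_nonneg.mpr hq.le)))⟩
  rw [norm_mul, norm_pow]
  exact mul_le_of_le_one_right (norm_nonneg _) (pow_le_one₀ (norm_nonneg _) hq.le)

theorem one_sub (hq : ‖q‖ < 1) (hφ : Differentiable ℂ φ) :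
    BoundedHolomorphic ρ fun w r => 1 - φ w * q ^ (2 * r) := by
  obtain ⟨A, hA⟩ := exists_bound hφ.continuous ρ
  refine ⟨fun r => (hφ.mul_const _).const_sub 1, 1 + A, fun w hw r => ?_⟩
  refine (norm_sub_le _ _).trans ?_
  rw [norm_one, norm_mul, norm_pow]
  gcongr
  exact (mul_le_of_le_one_right (norm_nonneg _) (pow_le_one₀ (norm_nonneg _) hq.le)).trans (hA w hw)

/-- Weierstrass M-test: the product is at most a constant times `R ^ r` and `f` is bounded, so a
geometric series of ratio `‖u‖ * R` dominates. -/
theorem summable_and_differentiableOn (hf : BoundedHolomorphic ρ f) (hq : ‖q‖ < 1)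
    (hφ : Differentiable ℂ φ) {R : ℝ} (hR : 0 < R) (hφR : ∀ w ∈ Metric.ball (0 : ℂ) ρ, ‖φ w‖ ≤ R)
    {u : ℂ} (hu : ‖u‖ * R < 1) (c : ℂ) :
    (∀ w ∈ Metric.ball (0 : ℂ) ρ,
      Summable fun r => u ^ r * (∏ i ∈ range r, (φ w - c * q ^ i)) * f w r) ∧
    DifferentiableOn ℂ (fun w => ∑' r, u ^ r * (∏ i ∈ range r, (φ w - c * q ^ i)) * f w r)
      (Metric.ball 0 ρ) := by
  obtain ⟨hf, C, hC⟩ := hf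
  have hs : Summable fun r => (‖u‖ * R) ^ r * (Real.exp (‖c‖ / R / (1 - ‖q‖)) * C) :=
    (summable_geometric_of_lt_one (by positivity) hu).mul_right _
  have hb : ∀ r, ∀ w ∈ Metric.ball (0 : ℂ) ρ,
      ‖u ^ r * (∏ i ∈ range r, (φ w - c * q ^ i)) * f w r‖ ≤
        (‖u‖ * R) ^ r * (Real.exp (‖c‖ / R / (1 - ‖q‖)) * C) := by
    intro r w hw
    rw [norm_mul, norm_mul, norm_pow, mul_pow]
    calc _ ≤ ‖u‖ ^ r * (R ^ r * Real.exp (‖c‖ / R / (1 - ‖q‖))) * C := by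
          gcongr
          · exact norm_prod_sub_le hq hR (hφR w hw) r
          · exact hC w hw r
      _ = _ := by ring
  refine ⟨fun w hw => Summable.of_norm_bounded hs fun r => hb r w hw,
    Complex.differentiableOn_tsum_of_summable_norm hs (fun r => ?_) Metric.isOpen_ball hb⟩
  have := hf r
  exact (Differentiable.mul (by fun_prop) this).differentiableOn

end BoundedHolomorphic

/-- Moves an `α`-dependent denominator into an entire numerator, at the price of a factor
independent of `r` that leaves the sum. -/
theorem inv_qPoch_eq {a q : ℂ} (hq : ‖q‖ < 1) (h : ∀ n : ℕ, a * q ^ n ≠ 1) (r : ℕ) :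
    (qPoch a q r)⁻¹ = qPochInf (a * q ^ r) q * (qPochInf a q)⁻¹ := by
  have h1 := qPoch_ne_zero h r
  have h2 := qPochInf_ne_zero hq h
  field_simp
  exact qPochInf_eq_qPoch_mul a hq r

theorem exists_norm_mul_le {c d : ℕ → ℂ} (hc : ∃ C, ∀ r, ‖c r‖ ≤ C) (hd : ∃ C, ∀ r, ‖d r‖ ≤ C) :
    ∃ C, ∀ r, ‖c r * d r‖ ≤ C := by
  obtain ⟨C, hC⟩ := hc
  obtain ⟨D, hD⟩ := hd
  refine ⟨C * D, fun r => ?_⟩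
  rw [norm_mul]
  exact mul_le_mul (hC r) (hD r) (norm_nonneg _) ((norm_nonneg _).trans (hC r))

theorem exists_norm_qPoch_le (a : ℂ) {q : ℂ} (hq : ‖q‖ < 1) : ∃ C, ∀ r, ‖qPoch a q r‖ ≤ C :=
  ⟨_, norm_qPoch_le a hq⟩

/-! ### The terms as functions of `α` along `x = αξ`. -/

/-- The factors of the terms of the series with base `q` that stay bounded, for `x = α ξ`. -/
noncomputable def leftFactor (p Q z β ξ α : ℂ) (r : ℕ) : ℂ :=
  qPoch (-(p * z / β)) Q r * qPoch (p * β * z) Q r * (qPoch Q Q r)⁻¹ *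
    (qPoch (Q * z ^ 2) Q r)⁻¹ * (qPoch (p ^ 3 * ξ * z) Q r)⁻¹ *
  (qPoch (-(α * z)) Q r * qPoch (-(p * (α * ξ))) Q r * qPoch (-(p * (α * ξ) * z ^ 2)) Q r *
    (1 - -(p * (α * ξ) * z ^ 2) * Q ^ (2 * r)) * qPochInf (Q * β * (α * ξ) * z * Q ^ r) Q *
    qPochInf (-(Q * (α * ξ) * z / β) * Q ^ r) Q * qPochInf (-(p * α * (α * ξ) * z) * Q ^ r) Q)

/-- The factors of the terms of the series with base `q²` that stay bounded, for `x = α ξ`. -/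
noncomputable def rightFactor (Q z β ξ α : ℂ) (r : ℕ) : ℂ :=
  (1 - -(Q * β * ξ * z ^ 4) * (Q ^ 2) ^ (2 * r)) * (1 - -(Q * β * ξ * z ^ 4))⁻¹ *
    qPoch (-(Q * β * ξ * z ^ 4)) (Q ^ 2) r * qPoch (-(Q * z ^ 2)) (Q ^ 2) r *
    qPoch (-z ^ 2) (Q ^ 2) r * qPoch (Q * β ^ 2 * z ^ 2) (Q ^ 2) r *
    qPoch (-(Q * β * ξ)) (Q ^ 2) r * (qPoch (Q ^ 2) (Q ^ 2) r)⁻¹ *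
    (qPoch (Q ^ 2 * β * ξ * z ^ 2) (Q ^ 2) r)⁻¹ *
    (qPoch (Q ^ 2 * β * ξ * z ^ 2 * Q) (Q ^ 2) r)⁻¹ *
    (qPoch (-(Q ^ 2 * ξ * z ^ 2 / β)) (Q ^ 2) r)⁻¹ * (qPoch (Q ^ 2 * z ^ 4) (Q ^ 2) r)⁻¹ *
  qPochInf (-(Q * α ^ 2 * β * ξ * z ^ 2) * (Q ^ 2) ^ r) (Q ^ 2)

/-- The denominators from `e1`, `e2` and `e4` depend on `α` and are inverted by `inv_qPoch_eq`;
those from `e0`, `e3` and `e5` are constant along `x = αξ`. -/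
theorem W87Term_left {p Q z β ξ α : ℂ} (hQ1 : ‖Q‖ < 1) (hp2 : p ^ 2 = Q) (hp : p ≠ 0)
    (hz : z ≠ 0) (hβ : β ≠ 0) (hξ : ξ ≠ 0) (hα : α ≠ 0)
    (h1 : ∀ n : ℕ, Q * β * (α * ξ) * z * Q ^ n ≠ 1)
    (h2 : ∀ n : ℕ, -(Q * (α * ξ) * z / β) * Q ^ n ≠ 1)
    (h4 : ∀ n : ℕ, -(p * α * (α * ξ) * z) * Q ^ n ≠ 1) (r : ℕ) :
    W87Term ![-(p * (α * ξ) * z ^ 2), Q * z / α, -(p * z / β), -(α * z), p * β * z,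
      -(p * (α * ξ))] Q (-(p * (α * ξ))) r =
    ((1 - -(p * (α * ξ) * z ^ 2)) * (qPochInf (Q * β * (α * ξ) * z) Q *
      qPochInf (-(Q * (α * ξ) * z / β)) Q * qPochInf (-(p * α * (α * ξ) * z)) Q))⁻¹ *
    ((-(p * ξ)) ^ r * (∏ i ∈ range r, (α - Q * z * Q ^ i)) * leftFactor p Q z β ξ α r) := by
  have h0 : Q ≠ 0 := by rw [← hp2]; exact pow_ne_zero 2 hp
  have e0 : Q * -(p * (α * ξ) * z ^ 2) / -(p * (α * ξ) * z ^ 2) = Q := by field_simp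
  have e1 : Q * -(p * (α * ξ) * z ^ 2) / (Q * z / α) = -(p * α * (α * ξ) * z) := by field_simp
  have e2 : Q * -(p * (α * ξ) * z ^ 2) / -(p * z / β) = Q * β * (α * ξ) * z := by field_simp
  have e3 : Q * -(p * (α * ξ) * z ^ 2) / -(α * z) = p ^ 3 * ξ * z := by
    rw [← hp2]; field_simp
  have e4 : Q * -(p * (α * ξ) * z ^ 2) / (p * β * z) = -(Q * (α * ξ) * z / β) := by field_simp
  have e5 : Q * -(p * (α * ξ) * z ^ 2) / -(p * (α * ξ)) = Q * z ^ 2 := by field_simp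
  simp only [W87Term, Fin.prod_univ_six, Matrix.cons_val, e0, e1, e2, e3, e4, e5, leftFactor]
  rw [← qPoch_div_mul_pow _ _ hα, show -(p * (α * ξ)) = -(p * ξ) * α by ring, mul_pow]
  simp only [div_eq_mul_inv (qPoch _ _ _), inv_qPoch_eq hQ1 h1, inv_qPoch_eq hQ1 h2,
    inv_qPoch_eq hQ1 h4, mul_inv]
  ring

/-- Along `x = αξ` only the denominator paired with `Q²z²/α²` still depends on `α`. -/
theorem W87Term_right {Q z β ξ α : ℂ} (hQ1 : ‖Q‖ < 1) (h0 : Q ≠ 0)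
    (hz : z ≠ 0) (hβ : β ≠ 0) (hξ : ξ ≠ 0) (hα : α ≠ 0)
    (h9 : ∀ n : ℕ, -(Q * α * β * (α * ξ) * z ^ 2) * (Q ^ 2) ^ n ≠ 1) (r : ℕ) :
    W87Term ![-(Q * β * (α * ξ) * z ^ 4 / α), Q ^ 2 * z ^ 2 / α ^ 2, -(Q * z ^ 2), -z ^ 2,
      Q * β ^ 2 * z ^ 2, -(Q * β * (α * ξ) / α)] (Q ^ 2) (-(Q * α * (α * ξ) / β)) r =
    (qPochInf (-(Q * α ^ 2 * β * ξ * z ^ 2)) (Q ^ 2))⁻¹ *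
    ((-(Q * ξ / β)) ^ r * (∏ i ∈ range r, (α ^ 2 - Q ^ 2 * z ^ 2 * (Q ^ 2) ^ i)) *
      rightFactor Q z β ξ α r) := by
  have hQ2 : ‖Q ^ 2‖ < 1 := by
    rw [norm_pow]; exact pow_lt_one₀ (norm_nonneg Q) hQ1 two_ne_zero
  rw [show -(Q * β * (α * ξ) * z ^ 4 / α) = -(Q * β * ξ * z ^ 4) by field_simp,
    show -(Q * β * (α * ξ) / α) = -(Q * β * ξ) by field_simp,
    show -(Q * α * (α * ξ) / β) = -(Q * ξ / β) * α ^ 2 by field_simp]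
  have h9' : ∀ n : ℕ, -(Q * α ^ 2 * β * ξ * z ^ 2) * (Q ^ 2) ^ n ≠ 1 := fun n => by
    convert h9 n using 2; ring
  have e0 : Q ^ 2 * -(Q * β * ξ * z ^ 4) / -(Q * β * ξ * z ^ 4) = Q ^ 2 := by field_simp
  have e1 : Q ^ 2 * -(Q * β * ξ * z ^ 4) / (Q ^ 2 * z ^ 2 / α ^ 2) =
      -(Q * α ^ 2 * β * ξ * z ^ 2) := by field_simp
  have e2 : Q ^ 2 * -(Q * β * ξ * z ^ 4) / -(Q * z ^ 2) = Q ^ 2 * β * ξ * z ^ 2 := by field_simp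
  have e3 : Q ^ 2 * -(Q * β * ξ * z ^ 4) / -z ^ 2 = Q ^ 2 * β * ξ * z ^ 2 * Q := by
    field_simp
  have e4 : Q ^ 2 * -(Q * β * ξ * z ^ 4) / (Q * β ^ 2 * z ^ 2) =
      -(Q ^ 2 * ξ * z ^ 2 / β) := by field_simp
  have e5 : Q ^ 2 * -(Q * β * ξ * z ^ 4) / -(Q * β * ξ) = Q ^ 2 * z ^ 4 := by field_simp
  simp only [W87Term, Fin.prod_univ_six, Matrix.cons_val, e0, e1, e2, e3, e4, e5, rightFactor]
  rw [← qPoch_div_mul_pow _ _ (pow_ne_zero 2 hα), mul_pow]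
  simp only [div_eq_mul_inv (qPoch _ _ _), inv_qPoch_eq hQ2 h9']
  ring

theorem boundedHolomorphic_leftFactor {p Q z β ξ : ℂ} (hQ1 : ‖Q‖ < 1)
    (hq : ∀ n : ℕ, Q * Q ^ n ≠ 1) (h3 : ∀ n : ℕ, p ^ 3 * ξ * z * Q ^ n ≠ 1)
    (h5 : ∀ n : ℕ, Q * z ^ 2 * Q ^ n ≠ 1) (ρ : ℝ) :
    BoundedHolomorphic ρ (leftFactor p Q z β ξ) := by
  refine BoundedHolomorphic.mul (.const ?_) ?_
  · exact exists_norm_mul_le (exists_norm_mul_le (exists_norm_mul_le (exists_norm_mul_le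
      (exists_norm_qPoch_le _ hQ1) (exists_norm_qPoch_le _ hQ1)) (norm_qPoch_inv_bounded hQ1 hq))
      (norm_qPoch_inv_bounded hQ1 h5)) (norm_qPoch_inv_bounded hQ1 h3)
  · exact ((((((BoundedHolomorphic.qPoch hQ1 (by fun_prop)).mul (.qPoch hQ1 (by fun_prop))).mul
      (.qPoch hQ1 (by fun_prop))).mul (.one_sub hQ1 (by fun_prop))).mul
      (.qPochInf hQ1 (by fun_prop))).mul (.qPochInf hQ1 (by fun_prop))).mul
      (.qPochInf hQ1 (by fun_prop))

theorem boundedHolomorphic_rightFactor {Q z β ξ : ℂ} (hQ1 : ‖Q‖ < 1)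
    (hq : ∀ n : ℕ, Q * Q ^ n ≠ 1)
    (h7 : ∀ n : ℕ, Q ^ 2 * β * ξ * z ^ 2 * Q ^ n ≠ 1)
    (h8 : ∀ n : ℕ, -(Q ^ 2 * ξ * z ^ 2 / β) * (Q ^ 2) ^ n ≠ 1)
    (h10 : ∀ n : ℕ, Q ^ 2 * z ^ 4 * (Q ^ 2) ^ n ≠ 1) (ρ : ℝ) :
    BoundedHolomorphic ρ (rightFactor Q z β ξ) := by
  have hQ2 : ‖Q ^ 2‖ < 1 := by
    rw [norm_pow]; exact pow_lt_one₀ (norm_nonneg Q) hQ1 two_ne_zero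
  have hq2 : ∀ n : ℕ, Q ^ 2 * (Q ^ 2) ^ n ≠ 1 := fun n => by
    convert hq (2 * n + 1) using 1; ring
  have h7a : ∀ n : ℕ, Q ^ 2 * β * ξ * z ^ 2 * (Q ^ 2) ^ n ≠ 1 := fun n => by
    convert h7 (2 * n) using 1; ring
  have h7b : ∀ n : ℕ, Q ^ 2 * β * ξ * z ^ 2 * Q * (Q ^ 2) ^ n ≠ 1 := fun n => by
    convert h7 (2 * n + 1) using 1; ring
  refine BoundedHolomorphic.mul (.const ?_) (.qPochInf hQ2 (by fun_prop))
  obtain ⟨-, C, hC⟩ := BoundedHolomorphic.one_sub (ρ := 1) hQ2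
    (differentiable_const (-(Q * β * ξ * z ^ 4)))
  refine exists_norm_mul_le (exists_norm_mul_le (exists_norm_mul_le (exists_norm_mul_le
    (exists_norm_mul_le (exists_norm_mul_le (exists_norm_mul_le (exists_norm_mul_le
    (exists_norm_mul_le (exists_norm_mul_le (exists_norm_mul_le ⟨C, hC 0 (by simp)⟩
    ⟨_, fun _ => le_rfl⟩) ?_) ?_) ?_) ?_) ?_) ?_) ?_) ?_) ?_) ?_
  exacts [exists_norm_qPoch_le _ hQ2, exists_norm_qPoch_le _ hQ2, exists_norm_qPoch_le _ hQ2,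
    exists_norm_qPoch_le _ hQ2, exists_norm_qPoch_le _ hQ2, norm_qPoch_inv_bounded hQ2 hq2,
    norm_qPoch_inv_bounded hQ2 h7a, norm_qPoch_inv_bounded hQ2 h7b,
    norm_qPoch_inv_bounded hQ2 h8, norm_qPoch_inv_bounded hQ2 h10]

/-- Supplies the `α`-dependent non-vanishing hypotheses at the points `z Q^{n+1}` with `n` large. -/
theorem eventually_mul_pow_ne_one {q : ℂ} (hq : ‖q‖ < 1) {φ : ℂ → ℂ} (hφ : Continuous φ)
    (h0 : φ 0 = 0) : ∀ᶠ w in nhds (0 : ℂ), ∀ n : ℕ, φ w * q ^ n ≠ 1 := by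
  have h : Filter.Tendsto (fun w => ‖φ w‖) (nhds 0) (nhds 0) := by
    have := (hφ.norm).tendsto 0
    rwa [h0, norm_zero] at this
  filter_upwards [h.eventually (gt_mem_nhds one_pos)] with w hw n hn
  have h' := congrArg norm hn
  rw [norm_mul, norm_pow, norm_one] at h'
  have := mul_le_mul_of_nonneg_left (pow_le_one₀ (norm_nonneg q) hq.le (n := n))
    (norm_nonneg (φ w))
  linarith

/-! ### Analytic continuation in `α`. -/

/-- The series on the left-hand side as a function of `α`, with `x = α ξ`. -/
noncomputable def leftSeries (p Q z β ξ α : ℂ) : ℂ :=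
  ∑' r, (-(p * ξ)) ^ r * (∏ i ∈ range r, (α - Q * z * Q ^ i)) * leftFactor p Q z β ξ α r

/-- The series on the right-hand side as a function of `α`, with `x = α ξ`. -/
noncomputable def rightSeries (Q z β ξ α : ℂ) : ℂ :=
  ∑' r, (-(Q * ξ / β)) ^ r * (∏ i ∈ range r, (α ^ 2 - Q ^ 2 * z ^ 2 * (Q ^ 2) ^ i)) *
    rightFactor Q z β ξ α r

/-- The three infinite products created by `inv_qPoch_eq` cancel against the prefactor, and `1 - α₀`
joins `(-p³xz²; Q)_∞` to form `(-pxz²; Q)_∞`. What is left makes sense at `α = 0`. -/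
theorem left_side_eq {p Q z β ξ α : ℂ} (hQ1 : ‖Q‖ < 1) (hp2 : p ^ 2 = Q) (hp : p ≠ 0)
    (hz : z ≠ 0) (hβ : β ≠ 0) (hξ : ξ ≠ 0) (hα : α ≠ 0)
    (h1 : ∀ n : ℕ, Q * β * (α * ξ) * z * Q ^ n ≠ 1)
    (h2 : ∀ n : ℕ, -(Q * (α * ξ) * z / β) * Q ^ n ≠ 1)
    (h4 : ∀ n : ℕ, -(p * α * (α * ξ) * z) * Q ^ n ≠ 1)
    (h6 : ∀ n : ℕ, -(p * (α * ξ) * z ^ 2) * Q ^ n ≠ 1) :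
    qPochInfs [Q * β * (α * ξ) * z, -(Q * (α * ξ) * z / β), p ^ 3 * (α * ξ) * z / α,
        -(p * α * (α * ξ) * z)] Q /
      qPochInfs [p * (α * ξ), -(p ^ 3 * (α * ξ) * z ^ 2), Q ^ 2 * β * (α * ξ) * z ^ 2 / α] Q *
      W87 ![-(p * (α * ξ) * z ^ 2), Q * z / α, -(p * z / β), -(α * z), p * β * z,
        -(p * (α * ξ))] Q (-(p * (α * ξ))) =
    qPochInf (p ^ 3 * ξ * z) Q * leftSeries p Q z β ξ α /
      (qPochInf (p * (α * ξ)) Q * qPochInf (-(p * (α * ξ) * z ^ 2)) Q *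
        qPochInf (Q ^ 2 * β * ξ * z ^ 2) Q) := by
  have hW : W87 ![-(p * (α * ξ) * z ^ 2), Q * z / α, -(p * z / β), -(α * z), p * β * z,
        -(p * (α * ξ))] Q (-(p * (α * ξ))) = _ :=
    tsum_congr (W87Term_left hQ1 hp2 hp hz hβ hξ hα h1 h2 h4)
  rw [tsum_mul_left, ← leftSeries] at hW
  have i6 := qPochInf_eq_qPoch_mul (-(p * (α * ξ) * z ^ 2)) hQ1 1
  rw [show qPoch (-(p * (α * ξ) * z ^ 2)) Q 1 = 1 - -(p * (α * ξ) * z ^ 2) by simp [qPoch],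
    show -(p * (α * ξ) * z ^ 2) * Q ^ 1 = -(p ^ 3 * (α * ξ) * z ^ 2) by rw [← hp2]; ring] at i6
  have n1 := qPochInf_ne_zero hQ1 h1
  have n2 := qPochInf_ne_zero hQ1 h2
  have n4 := qPochInf_ne_zero hQ1 h4
  have n6 := qPochInf_ne_zero hQ1 h6
  rw [hW, i6, show Q ^ 2 * β * ξ * z ^ 2 = Q ^ 2 * β * (α * ξ) * z ^ 2 / α by field_simp,
    show p ^ 3 * ξ * z = p ^ 3 * (α * ξ) * z / α by field_simp]
  rw [i6] at n6
  have n7 := left_ne_zero_of_mul n6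
  simp only [qPochInfs, List.map_cons, List.map_nil, List.prod_cons, List.prod_nil, mul_one]
  generalize qPochInf (Q * β * (α * ξ) * z) Q = X1 at *
  generalize qPochInf (-(Q * (α * ξ) * z / β)) Q = X2 at *
  generalize qPochInf (-(p * α * (α * ξ) * z)) Q = X4 at *
  generalize 1 - -(p * (α * ξ) * z ^ 2) = X5 at *
  simp only [div_eq_mul_inv, mul_inv]
  have c1 := mul_inv_cancel₀ n1
  have c2 := mul_inv_cancel₀ n2
  have c4 := mul_inv_cancel₀ n4
  generalize leftSeries p Q z β ξ α = S
  generalize qPochInf (p ^ 3 * (α * ξ) * z * α⁻¹) Q = Z1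
  generalize (qPochInf (p * (α * ξ)) Q)⁻¹ = Z2
  generalize (qPochInf (-(p ^ 3 * (α * ξ) * z ^ 2)) Q)⁻¹ = Z3
  generalize (qPochInf (Q ^ 2 * β * (α * ξ) * z ^ 2 * α⁻¹) Q)⁻¹ = Z4
  field_simp

theorem right_side_eq {Q z β ξ α : ℂ} (hQ1 : ‖Q‖ < 1) (h0 : Q ≠ 0)
    (hz : z ≠ 0) (hβ : β ≠ 0) (hξ : ξ ≠ 0) (hα : α ≠ 0)
    (h9 : ∀ n : ℕ, -(Q * α * β * (α * ξ) * z ^ 2) * (Q ^ 2) ^ n ≠ 1) :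
    qPochInfs [-(Q ^ 2 * (α * ξ) * z ^ 2 / (α * β)), -(Q * α * β * (α * ξ) * z ^ 2),
        -(Q * α * (α * ξ) / β)] (Q ^ 2) /
      qPochInfs [-(Q ^ 3 * β * (α * ξ) * z ^ 4 / α)] (Q ^ 2) *
      W87 ![-(Q * β * (α * ξ) * z ^ 4 / α), Q ^ 2 * z ^ 2 / α ^ 2, -(Q * z ^ 2), -z ^ 2,
        Q * β ^ 2 * z ^ 2, -(Q * β * (α * ξ) / α)] (Q ^ 2) (-(Q * α * (α * ξ) / β)) =
    qPochInf (-(Q ^ 2 * ξ * z ^ 2 / β)) (Q ^ 2) / qPochInf (-(Q ^ 3 * β * ξ * z ^ 4)) (Q ^ 2) *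
      (qPochInf (-(Q * ξ / β * α ^ 2)) (Q ^ 2) * rightSeries Q z β ξ α) := by
  have hQ2 : ‖Q ^ 2‖ < 1 := by
    rw [norm_pow]; exact pow_lt_one₀ (norm_nonneg Q) hQ1 two_ne_zero
  have hW : W87 ![-(Q * β * (α * ξ) * z ^ 4 / α), Q ^ 2 * z ^ 2 / α ^ 2, -(Q * z ^ 2), -z ^ 2,
        Q * β ^ 2 * z ^ 2, -(Q * β * (α * ξ) / α)] (Q ^ 2) (-(Q * α * (α * ξ) / β)) = _ :=
    tsum_congr (W87Term_right hQ1 h0 hz hβ hξ hα h9)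
  rw [tsum_mul_left, ← rightSeries] at hW
  have n9 := qPochInf_ne_zero hQ2 h9
  rw [show -(Q * α * β * (α * ξ) * z ^ 2) = -(Q * α ^ 2 * β * ξ * z ^ 2) by ring] at n9
  rw [hW]
  simp only [qPochInfs, List.map_cons, List.map_nil, List.prod_cons, List.prod_nil, mul_one]
  rw [show -(Q * α * β * (α * ξ) * z ^ 2) = -(Q * α ^ 2 * β * ξ * z ^ 2) by ring,
    show -(Q ^ 2 * (α * ξ) * z ^ 2 / (α * β)) = -(Q ^ 2 * ξ * z ^ 2 / β) by field_simp,
    show -(Q * α * (α * ξ) / β) = -(Q * ξ / β * α ^ 2) by field_simp,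
    show -(Q ^ 3 * β * (α * ξ) * z ^ 4 / α) = -(Q ^ 3 * β * ξ * z ^ 4) by field_simp]
  generalize qPochInf (-(Q * α ^ 2 * β * ξ * z ^ 2)) (Q ^ 2) = X at *
  field_simp

/-- Both convergence conditions are open, so they persist on a disc slightly larger than `‖α‖`. -/
theorem exists_radius {α A B : ℂ} (hA : ‖A * α‖ < 1) (hB : ‖B * α ^ 2‖ < 1) :
    ∃ ρ : ℝ, ‖α‖ < ρ ∧ ‖A‖ * ρ < 1 ∧ ‖B‖ * ρ ^ 2 < 1 := by
  rw [norm_mul] at hA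
  rw [norm_mul, norm_pow] at hB
  have h1 : ∀ᶠ ρ in nhds ‖α‖, ‖A‖ * ρ < 1 :=
    (show Continuous fun ρ : ℝ => ‖A‖ * ρ by fun_prop).continuousAt.eventually (gt_mem_nhds hA)
  have h2 : ∀ᶠ ρ in nhds ‖α‖, ‖B‖ * ρ ^ 2 < 1 :=
    (show Continuous fun ρ : ℝ => ‖B‖ * ρ ^ 2 by fun_prop).continuousAt.eventually
      (gt_mem_nhds hB)
  have h3 : ∀ᶠ ρ in nhdsWithin ‖α‖ (Set.Ioi ‖α‖), ‖α‖ < ρ := self_mem_nhdsWithin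
  exact (h3.and ((h1.and h2).filter_mono nhdsWithin_le_nhds)).exists

/-- The quadratic transformation with `x = α ξ`. -/
theorem quadratic_transformation {p Q z β ξ α : ℂ} (hQ1 : ‖Q‖ < 1) (hp2 : p ^ 2 = Q) (hp : p ≠ 0)
    (hz : z ≠ 0) (hβ : β ≠ 0) (hξ : ξ ≠ 0) (hα : α ≠ 0)
    (h1 : ∀ n : ℕ, Q * β * (α * ξ) * z * Q ^ n ≠ 1)
    (h2 : ∀ n : ℕ, -(Q * (α * ξ) * z / β) * Q ^ n ≠ 1)
    (h3 : ∀ n : ℕ, p ^ 3 * ξ * z * Q ^ n ≠ 1)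
    (h4 : ∀ n : ℕ, -(p * α * (α * ξ) * z) * Q ^ n ≠ 1)
    (h5 : ∀ n : ℕ, Q * z ^ 2 * Q ^ n ≠ 1)
    (h6 : ∀ n : ℕ, -(p * (α * ξ) * z ^ 2) * Q ^ n ≠ 1)
    (h7 : ∀ n : ℕ, Q ^ 2 * β * ξ * z ^ 2 * Q ^ n ≠ 1)
    (h8 : ∀ n : ℕ, -(Q ^ 2 * ξ * z ^ 2 / β) * (Q ^ 2) ^ n ≠ 1)
    (h9 : ∀ n : ℕ, -(Q * α * β * (α * ξ) * z ^ 2) * (Q ^ 2) ^ n ≠ 1)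
    (h10 : ∀ n : ℕ, Q ^ 2 * z ^ 4 * (Q ^ 2) ^ n ≠ 1)
    (h11 : ∀ n : ℕ, -(Q * β * ξ * z ^ 4) * (Q ^ 2) ^ n ≠ 1)
    (hL : ‖p * ξ * α‖ < 1) (hR : ‖Q * ξ / β * α ^ 2‖ < 1) :
    Summable (W87Term ![-(p * (α * ξ) * z ^ 2), Q * z / α, -(p * z / β), -(α * z), p * β * z,
        -(p * (α * ξ))] Q (-(p * (α * ξ)))) ∧
    Summable (W87Term ![-(Q * β * (α * ξ) * z ^ 4 / α), Q ^ 2 * z ^ 2 / α ^ 2, -(Q * z ^ 2),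
        -z ^ 2, Q * β ^ 2 * z ^ 2, -(Q * β * (α * ξ) / α)] (Q ^ 2) (-(Q * α * (α * ξ) / β))) ∧
    qPochInfs [Q * β * (α * ξ) * z, -(Q * (α * ξ) * z / β), p ^ 3 * (α * ξ) * z / α,
        -(p * α * (α * ξ) * z)] Q /
      qPochInfs [p * (α * ξ), -(p ^ 3 * (α * ξ) * z ^ 2), Q ^ 2 * β * (α * ξ) * z ^ 2 / α] Q *
      W87 ![-(p * (α * ξ) * z ^ 2), Q * z / α, -(p * z / β), -(α * z), p * β * z,
        -(p * (α * ξ))] Q (-(p * (α * ξ))) =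
    qPochInfs [-(Q ^ 2 * (α * ξ) * z ^ 2 / (α * β)), -(Q * α * β * (α * ξ) * z ^ 2),
        -(Q * α * (α * ξ) / β)] (Q ^ 2) /
      qPochInfs [-(Q ^ 3 * β * (α * ξ) * z ^ 4 / α)] (Q ^ 2) *
      W87 ![-(Q * β * (α * ξ) * z ^ 4 / α), Q ^ 2 * z ^ 2 / α ^ 2, -(Q * z ^ 2), -z ^ 2,
        Q * β ^ 2 * z ^ 2, -(Q * β * (α * ξ) / α)] (Q ^ 2) (-(Q * α * (α * ξ) / β)) := by
  have h0 : Q ≠ 0 := by rw [← hp2]; exact pow_ne_zero 2 hp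
  have hQ2 : ‖Q ^ 2‖ < 1 := by
    rw [norm_pow]; exact pow_lt_one₀ (norm_nonneg Q) hQ1 two_ne_zero
  have hq : ∀ n : ℕ, Q * Q ^ n ≠ 1 := fun n h => by
    have h' := congrArg norm h
    rw [← pow_succ', norm_pow, norm_one] at h'
    exact (pow_lt_one₀ (norm_nonneg _) hQ1 (Nat.succ_ne_zero n)).ne h'
  obtain ⟨ρ, hαρ, hAρ, hBρ⟩ := exists_radius hL hR
  have hρ : 0 < ρ := (norm_nonneg α).trans_lt hαρ
  have hαball : α ∈ Metric.ball (0 : ℂ) ρ := mem_ball_zero_iff.mpr hαρ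
  obtain ⟨sL, dL⟩ := (boundedHolomorphic_leftFactor (p := p) (β := β) hQ1 hq h3 h5
    ρ).summable_and_differentiableOn hQ1 (φ := fun w => w) differentiable_id hρ
    (fun w hw => (mem_ball_zero_iff.mp hw).le) (u := -(p * ξ)) (by rwa [norm_neg]) (Q * z)
  obtain ⟨sR, dR⟩ := (boundedHolomorphic_rightFactor hQ1 hq h7 h8 h10
    ρ).summable_and_differentiableOn hQ2 (φ := fun w => w ^ 2) (by fun_prop) (pow_pos hρ 2)
    (fun w hw => by
      rw [norm_pow]; exact pow_le_pow_left₀ (norm_nonneg w) (mem_ball_zero_iff.mp hw).le 2)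
    (u := -(Q * ξ / β)) (by rwa [norm_neg]) (Q ^ 2 * z ^ 2)
  refine ⟨?_, ?_, ?_⟩
  · rw [funext (W87Term_left hQ1 hp2 hp hz hβ hξ hα h1 h2 h4)]
    exact (sL α hαball).mul_left _
  · rw [funext (W87Term_right hQ1 h0 hz hβ hξ hα h9)]
    exact (sR α hαball).mul_left _
  have n7 := qPochInf_ne_zero hQ1 h7
  have npx : ∀ w ∈ Metric.ball (0 : ℂ) ρ, qPochInf (p * (w * ξ)) Q ≠ 0 := fun w hw =>
    qPochInf_ne_zero hQ1 fun n h => by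
      have h' := congrArg norm h
      rw [norm_mul, norm_pow, norm_one, show p * (w * ξ) = p * ξ * w by ring, norm_mul] at h'
      have e1 := mul_le_mul_of_nonneg_left (pow_le_one₀ (norm_nonneg Q) hQ1.le (n := n))
        (norm_nonneg (p * ξ * w))
      have e2 := mul_le_mul_of_nonneg_left (mem_ball_zero_iff.mp hw).le (norm_nonneg (p * ξ))
      rw [norm_mul (p * ξ)] at e1
      linarith
  -- The denominators of the left side are moved to `G`, because `(-pwξz²; Q)_∞` may vanish inside
  -- the disc.
  let F : ℂ → ℂ := fun w => qPochInf (p ^ 3 * ξ * z) Q * leftSeries p Q z β ξ w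
  let G : ℂ → ℂ := fun w => qPochInf (-(Q ^ 2 * ξ * z ^ 2 / β)) (Q ^ 2) /
    qPochInf (-(Q ^ 3 * β * ξ * z ^ 4)) (Q ^ 2) *
      (qPochInf (-(Q * ξ / β * w ^ 2)) (Q ^ 2) * rightSeries Q z β ξ w) *
      (qPochInf (p * (w * ξ)) Q * qPochInf (-(p * (w * ξ) * z ^ 2)) Q *
        qPochInf (Q ^ 2 * β * ξ * z ^ 2) Q)
  have hF : DifferentiableOn ℂ F (Metric.ball 0 ρ) := dL.const_mul _
  have dinf : ∀ {b : ℂ} {φ : ℂ → ℂ}, ‖b‖ < 1 → Differentiable ℂ φ →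
      DifferentiableOn ℂ (fun w => qPochInf (φ w) b) (Metric.ball 0 ρ) := fun hb hφ =>
    ((differentiable_qPochInf hb).comp hφ).differentiableOn
  have hG : DifferentiableOn ℂ G (Metric.ball 0 ρ) :=
    (((dinf hQ2 (by fun_prop)).mul dR).const_mul _).mul
      (((dinf hQ1 (by fun_prop)).mul (dinf hQ1 (by fun_prop))).mul_const _)
  have t0 : Filter.Tendsto (fun n : ℕ => z * Q ^ (n + 1)) Filter.atTop (nhds 0) := by
    have := ((Filter.tendsto_add_atTop_iff_nat 1).mpr
      (tendsto_pow_atTop_nhds_zero_of_norm_lt_one hQ1)).const_mul z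
    rwa [mul_zero] at this
  -- The identity theorem needs agreement at points different from the limit point `0`.
  have t1 : Filter.Tendsto (fun n : ℕ => z * Q ^ (n + 1)) Filter.atTop
      (nhdsWithin 0 {0}ᶜ) :=
    tendsto_nhdsWithin_iff.mpr ⟨t0, Filter.Eventually.of_forall fun n =>
      mul_ne_zero hz (pow_ne_zero _ h0)⟩
  have agree : ∀ᶠ n : ℕ in Filter.atTop, F (z * Q ^ (n + 1)) = G (z * Q ^ (n + 1)) := by
    have k1 := t0.eventually (eventually_mul_pow_ne_one hQ1
      (φ := fun w => Q * β * (w * ξ) * z) (by fun_prop) (by simp))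
    have k2 := t0.eventually (eventually_mul_pow_ne_one hQ1
      (φ := fun w => -(Q * (w * ξ) * z / β)) (by fun_prop) (by simp))
    have k4 := t0.eventually (eventually_mul_pow_ne_one hQ1
      (φ := fun w => -(p * w * (w * ξ) * z)) (by fun_prop) (by simp))
    have k6 := t0.eventually (eventually_mul_pow_ne_one hQ1
      (φ := fun w => -(p * (w * ξ) * z ^ 2)) (by fun_prop) (by simp))
    have k9 := t0.eventually (eventually_mul_pow_ne_one hQ2
      (φ := fun w => -(Q * w * β * (w * ξ) * z ^ 2)) (by fun_prop) (by simp))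
    have kb := t0.eventually (Metric.ball_mem_nhds (0 : ℂ) hρ)
    filter_upwards [k1, k2, k4, k6, k9, kb] with n k1 k2 k4 k6 k9 kb
    obtain ⟨w, hw⟩ : ∃ w, w = z * Q ^ (n + 1) := ⟨_, rfl⟩
    rw [← hw] at k1 k2 k4 k6 k9 kb ⊢
    have hw0 : w ≠ 0 := by rw [hw]; exact mul_ne_zero hz (pow_ne_zero _ h0)
    have key := quadratic_transformation_terminating (x := w * ξ) hQ1 hp2 h0
      (mul_ne_zero hw0 hξ) hz hβ hw k1 k2
      (by rwa [show p ^ 3 * (w * ξ) * z / w = p ^ 3 * ξ * z by field_simp]) k4 h5 k6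
      (by rwa [show Q ^ 2 * β * (w * ξ) * z ^ 2 / w = Q ^ 2 * β * ξ * z ^ 2 by field_simp])
      (by rwa [show -(Q ^ 2 * (w * ξ) * z ^ 2 / (w * β)) = -(Q ^ 2 * ξ * z ^ 2 / β) by
        field_simp]) k9 h10
      (by rwa [show -(Q * β * (w * ξ) * z ^ 4 / w) = -(Q * β * ξ * z ^ 4) by field_simp])
      (by
        rw [show p * (w * ξ) = p * ξ * w by ring, norm_mul]
        exact (mul_le_mul_of_nonneg_left (mem_ball_zero_iff.mp kb).le
          (norm_nonneg _)).trans_lt hAρ)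
    rw [left_side_eq hQ1 hp2 hp hz hβ hξ hw0 k1 k2 k4 k6,
      right_side_eq hQ1 h0 hz hβ hξ hw0 k9] at key
    exact (div_eq_iff (mul_ne_zero (mul_ne_zero (npx w kb) (qPochInf_ne_zero hQ1 k6)) n7)).mp key
  have hFG := AnalyticOnNhd.eqOn_of_preconnected_of_frequently_eq
    (hF.analyticOnNhd Metric.isOpen_ball) (hG.analyticOnNhd Metric.isOpen_ball)
    (convex_ball (0 : ℂ) ρ).isPreconnected (Metric.mem_ball_self hρ)
    (t1.frequently agree.frequently) hαball
  rw [left_side_eq hQ1 hp2 hp hz hβ hξ hα h1 h2 h4 h6, right_side_eq hQ1 h0 hz hβ hξ hα h9]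
  exact (div_eq_iff (mul_ne_zero (mul_ne_zero (npx α hαball)
    (qPochInf_ne_zero hQ1 h6)) n7)).mpr hFG

theorem mainTheorem2 (q : ℝ) (hq0 : 0 < q) (hq1 : q < 1)
    -- `p = q^{1/2}`, the positive square root, and `Q = q` seen as a complex number
    (p Q : ℂ) (hp : p = ((√q : ℝ) : ℂ)) (hQ : Q = ((q : ℝ) : ℂ))
    (x z α β : ℂ) (hx : x ≠ 0) (hz : z ≠ 0) (hα : α ≠ 0) (hβ : β ≠ 0)
    -- no denominator vanishes (base `q`)
    (h1 : ∀ n : ℕ, Q * β * x * z * Q ^ n ≠ 1)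
    (h2 : ∀ n : ℕ, -(Q * x * z / β) * Q ^ n ≠ 1)
    (h3 : ∀ n : ℕ, p ^ 3 * x * z / α * Q ^ n ≠ 1)
    (h4 : ∀ n : ℕ, -(p * α * x * z) * Q ^ n ≠ 1)
    (h5 : ∀ n : ℕ, Q * z ^ 2 * Q ^ n ≠ 1)
    (h6 : ∀ n : ℕ, -(p * x * z ^ 2) * Q ^ n ≠ 1)
    (h7 : ∀ n : ℕ, Q ^ 2 * β * x * z ^ 2 / α * Q ^ n ≠ 1)
    -- no denominator vanishes (base `q^2`)
    (h8 : ∀ n : ℕ, -(Q ^ 2 * x * z ^ 2 / (α * β)) * (Q ^ 2) ^ n ≠ 1)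
    (h9 : ∀ n : ℕ, -(Q * α * β * x * z ^ 2) * (Q ^ 2) ^ n ≠ 1)
    (h10 : ∀ n : ℕ, Q ^ 2 * z ^ 4 * (Q ^ 2) ^ n ≠ 1)
    (h11 : ∀ n : ℕ, -(Q * β * x * z ^ 4 / α) * (Q ^ 2) ^ n ≠ 1)
    -- convergence conditions
    (hL : ‖p * x‖ < 1) (hR : ‖Q * α * x / β‖ < 1) :
    Summable (W87Term
        ![-(p * x * z ^ 2), Q * z / α, -(p * z / β), -(α * z), p * β * z, -(p * x)]
        Q (-(p * x))) ∧
    Summable (W87Term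
        ![-(Q * β * x * z ^ 4 / α), Q ^ 2 * z ^ 2 / α ^ 2, -(Q * z ^ 2), -z ^ 2,
          Q * β ^ 2 * z ^ 2, -(Q * β * x / α)]
        (Q ^ 2) (-(Q * α * x / β))) ∧
    qPochInfs [Q * β * x * z, -(Q * x * z / β), p ^ 3 * x * z / α, -(p * α * x * z)] Q /
        qPochInfs [p * x, -(p ^ 3 * x * z ^ 2), Q ^ 2 * β * x * z ^ 2 / α] Q *
      W87 ![-(p * x * z ^ 2), Q * z / α, -(p * z / β), -(α * z), p * β * z, -(p * x)]
        Q (-(p * x)) =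
    qPochInfs [-(Q ^ 2 * x * z ^ 2 / (α * β)), -(Q * α * β * x * z ^ 2), -(Q * α * x / β)]
          (Q ^ 2) /
        qPochInfs [-(Q ^ 3 * β * x * z ^ 4 / α)] (Q ^ 2) *
      W87 ![-(Q * β * x * z ^ 4 / α), Q ^ 2 * z ^ 2 / α ^ 2, -(Q * z ^ 2), -z ^ 2,
          Q * β ^ 2 * z ^ 2, -(Q * β * x / α)]
        (Q ^ 2) (-(Q * α * x / β)) := by
  have hp2 : p ^ 2 = Q := by
    rw [hp, hQ, ← Complex.ofReal_pow, Real.sq_sqrt hq0.le]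
  have hp0 : p ≠ 0 := by
    rw [hp]; exact Complex.ofReal_ne_zero.mpr (Real.sqrt_pos.mpr hq0).ne'
  have hQ1 : ‖Q‖ < 1 := by
    rw [hQ, Complex.norm_real, Real.norm_of_nonneg hq0.le]; exact hq1
  -- From here `ξ = x/α` is fixed and `α` is the variable; the two convergence conditions become
  -- bounds on `α` and `α²`.
  obtain ⟨ξ, rfl⟩ : ∃ ξ, x = α * ξ := ⟨x / α, by field_simp⟩
  have hξ : ξ ≠ 0 := right_ne_zero_of_mul hx
  refine quadratic_transformation hQ1 hp2 hp0 hz hβ hξ hα h1 h2 ?_ h4 h5 h6 ?_ ?_ h9 h10 ?_ ?_ ?_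
  · rwa [show p ^ 3 * ξ * z = p ^ 3 * (α * ξ) * z / α by field_simp]
  · rwa [show Q ^ 2 * β * ξ * z ^ 2 = Q ^ 2 * β * (α * ξ) * z ^ 2 / α by field_simp]
  · rwa [show -(Q ^ 2 * ξ * z ^ 2 / β) = -(Q ^ 2 * (α * ξ) * z ^ 2 / (α * β)) by field_simp]
  · rwa [show -(Q * β * ξ * z ^ 4) = -(Q * β * (α * ξ) * z ^ 4 / α) by field_simp]
  · rwa [show p * ξ * α = p * (α * ξ) by ring]
  · rwa [show Q * ξ / β * α ^ 2 = Q * α * (α * ξ) / β by ring]
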